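/- **Proposition 3.1.** Let $\nu,\kappa,L>0$ and $\Omega=(0,L)\times(0,1)$. Let $\mathcal F$ be the set of smooth functions on $\Omega$ that are trigonometric polynomials of period $L$ in $x_1$ and compactly supported in $x_2\in(0,1)$, and let $\mathcal V=\{\phi\in\mathcal F\times\mathcal F:\nabla\cdot\phi=0\}$. Let $H_0,H_1$ be the closures of $\mathcal V,\mathcal F$ in $L^2(\Omega)$, and $V_0,V_1$ their closures in $H^1(\Omega)$, with $((v,w))_{V_i}$ the $L^2$ scalar product of the gradients. For $i=0,1$ let $D(A_i)$ be the set of elements of $V_i$ that lie in $H^2$ ($L$-periodic in $x_1$), and define $A_i:D(A_i)\to H_i$ by $(A_iv,w)=((v,w))_{V_i}$ for all $w\in V_i$. Let $\mathcal P_\sigma$ be the orthogonal projector of $L^2(\Omega)^2$ onto $H_0$, and let $\langle B_0(u,v),w\rangle=((u\cdot\nabla)v,w)$ for $u,v,w\in V_0$, $\langle B_1(u,\psi),\phi\rangle=((u\cdot\nabla)\psi,\phi)$ for $u\in V_0$ and $\psi,\phi\in V_1$. Consider the two-dimensional Bénard system $$\frac{du}{dt}+\nu A_0u+B_0(u,u)=\mathcal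 P_\sigma(\theta\mathbf e_2),\qquad \frac{d\theta}{dt}+\kappa A_1\theta+B_1(u,\theta)-u\cdot\mathbf e_2=0 .$$ A strong solution on $[a,b]$ is a pair $(u,\theta)$ with $u\in C([a,b];V_0)\cap L^2(a,b;D(A_0))$, $\theta\in C([a,b];V_1)\cap L^2(a,b;D(A_1))$, $\frac{du}{dt}\in L^2(a,b;H_0)$ and $\frac{d\theta}{dt}\in L^2(a,b;H_1)$ that satisfies the two equations for almost every $t\in[a,b]$. For $t\ge0$ let $S(t)$ map the value at time $0$ of a strong solution on $[0,t]$ to its value at time $t$. Let $\mathcal A\subset V_0\times V_1$ be the global attractor of the system: $\mathcal A$ is compact in $H_0\times H_1$, $S(t)\mathcal A=\mathcal A$ for all $t\ge0$, and $\mathcal A$ attracts, in the norm of $H_0\times H_1$, every subset of $V_0\times V_1$ that is bounded in that norm. Let $(u_1,\theta_1)$ and $(u_2,\theta_2)$ be two complete trajectories in $\mathcal A$, that is, strong solutions on every bounded interval of $\mathbb R$ with $(u_i(t),\theta_i(t))\in\mathcal A$ for all $t\in\mathbb R$. If $u_1(t)=u_2(t)$ for all $t\in\mathbb R$, then $\theta_1(t)=\theta_2(t)$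 for all $t\in\mathbb R$. -/

import Mathlib

open MeasureTheory Set Filter Topology
open scoped ContDiff

namespace Benard

/-! ### The periodic channel, smooth fields -/

/-- Lebesgue measure on one period cell `Ω = (0, L) × (0, 1)` of the channel. -/
noncomputable def cell (L : ℝ) : Measure (ℝ × ℝ) :=
  volume.restrict (Ioo 0 L ×ˢ Ioo 0 1)

/-- Scalar fields: `L²(Ω)`. -/
abbrev Scal (L : ℝ) : Type := Lp ℝ 2 (cell L)

/-- Vector fields: `L²(Ω)²`, with inner product `∑ i, ∫ uᵢ vᵢ`. -/
abbrev Vec (L : ℝ) : Type := PiLp 2 (fun _ : Fin 2 => Scal L)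

/-- Classical partial derivative of `φ` in the `j`-th coordinate direction. -/
noncomputable def pderiv (j : Fin 2) (φ : ℝ × ℝ → ℝ) (x : ℝ × ℝ) : ℝ :=
  fderiv ℝ φ x (if j = 0 then (1, 0) else (0, 1))

/-- The class `𝓕`: trigonometric polynomials in `x₁` of period `L`, whose coefficients are smooth
functions of `x₂` with compact support in `(0, 1)`. -/
def IsTest (L : ℝ) (φ : ℝ × ℝ → ℝ) : Prop :=
  ∃ (N : ℕ) (a b : ℕ → ℝ → ℝ),
    (∀ k, ContDiff ℝ ∞ (a k) ∧ HasCompactSupport (a k) ∧ tsupport (a k) ⊆ Ioo 0 1) ∧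
    (∀ k, ContDiff ℝ ∞ (b k) ∧ HasCompactSupport (b k) ∧ tsupport (b k) ⊆ Ioo 0 1) ∧
    ∀ x : ℝ × ℝ, φ x = ∑ k ∈ Finset.range (N + 1),
      (a k x.2 * Real.cos (2 * Real.pi * k * x.1 / L) +
        b k x.2 * Real.sin (2 * Real.pi * k * x.1 / L))

/-- The class `𝓕`, as a subset of `L²(Ω)`. -/
def testScal (L : ℝ) : Set (Scal L) :=
  {f | ∃ φ : ℝ × ℝ → ℝ, IsTest L φ ∧ f =ᵐ[cell L] φ}

/-- The class `𝓥` of divergence-free elements of `𝓕 × 𝓕`, as a subset of `L²(Ω)²`. -/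
def testVec (L : ℝ) : Set (Vec L) :=
  {u | ∃ φ : Fin 2 → ℝ × ℝ → ℝ, (∀ i, IsTest L (φ i)) ∧ (∀ x, ∑ j, pderiv j (φ j) x = 0) ∧
    ∀ i, u i =ᵐ[cell L] φ i}

/-! ### Weak derivatives and Sobolev spaces -/

/-- `g` is the weak derivative `∂ⱼ f` on the channel that is `L`-periodic in `x₁`. The test
functions are periodic in `x₁` (and supported away from the walls), so periodicity of `f` across
`x₁ = 0` and `x₁ = L` is part of weak differentiability. -/
def HasWeakDeriv (L : ℝ) (j : Fin 2) (f g : Scal L) : Prop :=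
  ∀ φ : ℝ × ℝ → ℝ, IsTest L φ →
    ∫ x, f x * pderiv j φ x ∂(cell L) = -∫ x, g x * φ x ∂(cell L)

open Classical in
/-- The weak derivative `∂ⱼ f` (zero if there is none in `L²`). -/
noncomputable def weakDeriv (L : ℝ) (j : Fin 2) (f : Scal L) : Scal L :=
  if h : ∃ g, HasWeakDeriv L j f g then h.choose else 0

/-- `H¹(Ω)`, periodic in `x₁`. -/
def sobolev1 (L : ℝ) : Set (Scal L) := {f | ∀ j, ∃ g, HasWeakDeriv L j f g}

/-- `H²(Ω)`, periodic in `x₁`. -/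
def sobolev2 (L : ℝ) : Set (Scal L) :=
  {f | f ∈ sobolev1 L ∧ ∀ j, weakDeriv L j f ∈ sobolev1 L}

/-- `f ↦ (f, ∇f)`. The `H¹` topology is the one induced by this map. -/
noncomputable def jetScal (L : ℝ) (f : Scal L) : Scal L × (Fin 2 → Scal L) :=
  (f, fun j => weakDeriv L j f)

/-- `u ↦ (u, ∇u)`. The `H¹` topology is the one induced by this map. -/
noncomputable def jetVec (L : ℝ) (u : Vec L) : Vec L × (Fin 2 → Fin 2 → Scal L) :=
  (u, fun i j => weakDeriv L j (u i))

/-! ### The spaces `H₀, H₁, V₀, V₁` -/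

/-- `H₀`: closure of `𝓥` in `L²(Ω)²` (`𝓥` is a linear subspace, so the span adds nothing). -/
noncomputable def H0 (L : ℝ) : Submodule ℝ (Vec L) :=
  (Submodule.span ℝ (testVec L)).topologicalClosure

/-- `H₁`: closure of `𝓕` in `L²(Ω)` (`𝓕` is a linear subspace, so the span adds nothing). -/
noncomputable def H1 (L : ℝ) : Submodule ℝ (Scal L) :=
  (Submodule.span ℝ (testScal L)).topologicalClosure

/-- `V₀`: closure of `𝓥` in `H¹(Ω)²`. -/
def V0 (L : ℝ) : Set (Vec L) :=
  {u | (∀ i, u i ∈ sobolev1 L) ∧ jetVec L u ∈ closure (jetVec L '' testVec L)}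

/-- `V₁`: closure of `𝓕` in `H¹(Ω)`. -/
def V1 (L : ℝ) : Set (Scal L) :=
  {f | f ∈ sobolev1 L ∧ jetScal L f ∈ closure (jetScal L '' testScal L)}

/-- The scalar product `((u, v))` of `V₀`. -/
noncomputable def form0 (L : ℝ) (u v : Vec L) : ℝ :=
  ∑ i, ∑ j, inner ℝ (weakDeriv L j (u i)) (weakDeriv L j (v i))

/-- The scalar product `((ψ, φ))` of `V₁`. -/
noncomputable def form1 (L : ℝ) (ψ φ : Scal L) : ℝ :=
  ∑ j, inner ℝ (weakDeriv L j ψ) (weakDeriv L j φ)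

/-! ### The operators `A₀, A₁, B₀, B₁` and the Helmholtz-Leray projector -/

/-- `D(A₀) = V₀ ∩ H²`. -/
def domA0 (L : ℝ) : Set (Vec L) := {u | u ∈ V0 L ∧ ∀ i, u i ∈ sobolev2 L}

/-- `D(A₁) = V₁ ∩ H²`. -/
def domA1 (L : ℝ) : Set (Scal L) := V1 L ∩ sobolev2 L

open Classical in
/-- `A₀ u`: the element of `H₀` with `(A₀ u, w) = ((u, w))` for all `w ∈ V₀`
(used for `u ∈ D(A₀)`, where it exists; zero if there is none). -/
noncomputable def A0 (L : ℝ) (u : Vec L) : Vec L :=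
  if h : ∃ f ∈ H0 L, ∀ w ∈ V0 L, inner ℝ f w = form0 L u w then h.choose else 0

open Classical in
/-- `A₁ ψ`: the element of `H₁` with `(A₁ ψ, φ) = ((ψ, φ))` for all `φ ∈ V₁`
(used for `ψ ∈ D(A₁)`, where it exists; zero if there is none). -/
noncomputable def A1 (L : ℝ) (ψ : Scal L) : Scal L :=
  if h : ∃ f ∈ H1 L, ∀ φ ∈ V1 L, inner ℝ f φ = form1 L ψ φ then h.choose else 0

/-- `⟨B₀(u, v), w⟩ = ((u · ∇) v, w)`. -/
noncomputable def B0 (L : ℝ) (u v w : Vec L) : ℝ :=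
  ∫ x, ∑ i, (∑ j, u j x * weakDeriv L j (v i) x) * w i x ∂(cell L)

/-- `⟨B₁(u, ψ), φ⟩ = ((u · ∇) ψ, φ)`. -/
noncomputable def B1 (L : ℝ) (u : Vec L) (ψ φ : Scal L) : ℝ :=
  ∫ x, (∑ j, u j x * weakDeriv L j ψ x) * φ x ∂(cell L)

/-- The vector field `θ e₂`. -/
noncomputable def buoyancy (L : ℝ) (θ : Scal L) : Vec L := WithLp.toLp 2 ![0, θ]

/-- The Helmholtz-Leray projector: the orthogonal projector of `L²(Ω)²` onto `H₀`. -/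
noncomputable def leray (L : ℝ) : Vec L →L[ℝ] Vec L :=
  haveI : CompleteSpace (H0 L) := (Submodule.isClosed_topologicalClosure _).completeSpace_coe
  (H0 L).starProjection

/-! ### Strong solutions -/

/-- `(u, θ)` is a strong solution of the Bénard system on the time interval `[a, b]`:
`u ∈ C([a,b]; V₀) ∩ L²(a,b; D(A₀))`, `θ ∈ C([a,b]; V₁) ∩ L²(a,b; D(A₁))`, with time derivatives
`u' ∈ L²(a,b; H₀)`, `θ' ∈ L²(a,b; H₁)`, and for almost every `t`
`u' + ν A₀ u + B₀(u, u) = P(θ e₂)` in the dual of `V₀`,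
`θ' + κ A₁ θ + B₁(u, θ) - u · e₂ = 0` in the dual of `V₁`. -/
structure IsStrongSolution (ν κ L a b : ℝ) (u : ℝ → Vec L) (θ : ℝ → Scal L) : Prop where
  memV0 : ∀ t ∈ Icc a b, u t ∈ V0 L
  memV1 : ∀ t ∈ Icc a b, θ t ∈ V1 L
  cont_u : ContinuousOn (fun t => jetVec L (u t)) (Icc a b)
  cont_θ : ContinuousOn (fun t => jetScal L (θ t)) (Icc a b)
  mem_dom_u : ∀ᵐ t ∂(volume.restrict (Icc a b)), u t ∈ domA0 L
  mem_dom_θ : ∀ᵐ t ∂(volume.restrict (Icc a b)), θ t ∈ domA1 L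
  sq_int_A0 : MemLp (fun t => A0 L (u t)) 2 (volume.restrict (Icc a b))
  sq_int_A1 : MemLp (fun t => A1 L (θ t)) 2 (volume.restrict (Icc a b))
  velocity : ∃ u' : ℝ → Vec L, MemLp u' 2 (volume.restrict (Icc a b)) ∧
    (∀ t ∈ Icc a b, u t = u a + ∫ s in a..t, u' s) ∧
    ∀ᵐ t ∂(volume.restrict (Icc a b)), u' t ∈ H0 L ∧ ∀ w ∈ V0 L,
      inner ℝ (u' t) w + ν * inner ℝ (A0 L (u t)) w + B0 L (u t) (u t) w
        = inner ℝ (leray L (buoyancy L (θ t))) w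
  temperature : ∃ θ' : ℝ → Scal L, MemLp θ' 2 (volume.restrict (Icc a b)) ∧
    (∀ t ∈ Icc a b, θ t = θ a + ∫ s in a..t, θ' s) ∧
    ∀ᵐ t ∂(volume.restrict (Icc a b)), θ' t ∈ H1 L ∧ ∀ φ ∈ V1 L,
      inner ℝ (θ' t) φ + κ * inner ℝ (A1 L (θ t)) φ + B1 L (u t) (θ t) φ
        - inner ℝ (u t 1) φ = 0

/-! ### The global attractor -/

/-- `S(t) B`: the states reached at time `t` by the strong solutions that start in `B`. -/
def evolve (ν κ L t : ℝ) (B : Set (Vec L × Scal L)) : Set (Vec L × Scal L) :=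
  {z | ∃ (u : ℝ → Vec L) (θ : ℝ → Scal L), IsStrongSolution ν κ L 0 t u θ ∧
    (u 0, θ 0) ∈ B ∧ (u t, θ t) = z}

/-- `𝒜` is the global attractor of the Bénard system: a set of states in `V₀ × V₁`, compact in
`H₀ × H₁`, invariant (`S(t) 𝒜 = 𝒜` for `t ≥ 0`), which attracts in `H₀ × H₁` all sets of initial
data in `V₀ × V₁` that are bounded in `H₀ × H₁`. These properties determine `𝒜`, and make it
maximal among the bounded invariant sets. -/
structure IsGlobalAttractor (ν κ L : ℝ) (𝒜 : Set (Vec L × Scal L)) : Prop where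
  subset : 𝒜 ⊆ V0 L ×ˢ V1 L
  compact : IsCompact 𝒜
  invariant : ∀ t, 0 ≤ t → evolve ν κ L t 𝒜 = 𝒜
  attracting : ∀ B ⊆ V0 L ×ˢ V1 L, Bornology.IsBounded B →
    ∀ ε > 0, ∃ T, 0 ≤ T ∧ ∀ t ≥ T, evolve ν κ L t B ⊆ Metric.thickening ε 𝒜

/-- `(u, θ)` is a complete trajectory in `𝒜`: a strong solution on the whole time axis `ℝ`, with
values in `𝒜`. -/
structure IsCompleteTrajectoryIn (ν κ L : ℝ) (𝒜 : Set (Vec L × Scal L))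
    (u : ℝ → Vec L) (θ : ℝ → Scal L) : Prop where
  solution : ∀ a b, a ≤ b → IsStrongSolution ν κ L a b u θ
  mem : ∀ t, (u t, θ t) ∈ 𝒜

end Benard

namespace Benard

/-! ### Integrals over the cell -/

/-! Let `η = θ₁ - θ₂`. With a common velocity `u`, subtracting the temperature equations cancels the
source `u · e₂` and leaves the linear equation `η' + κ A₁ η + (u · ∇) η = 0`. Testing with `η`
removes the transport term, because `u` is divergence free, and Poincaré's inequality on a channel
of height `1` bounds the dissipation below by `κ ‖η‖²`. So `‖η‖²` decays forward in time
(`IsStrongSolution.norm_sq_temperature_sub_le`). Both trajectories exist for all negative times and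
stay in a compact, hence bounded, set. A nonzero `η t` would force `η` to be unbounded in the past,
a contradiction.

The labour is in justifying this in the weak setting. `ae_eq_zero_of_forall_test` makes weak
derivatives unique. `exists_mul_of_mem_V1` puts products of `V₁` functions in `L²`, so that `B1` is
a convergent integral, continuous in its arguments; this gives the cancellation `B1_self` by
density. `inner_A1` identifies `A₁` with the Dirichlet form on its domain.
`norm_sq_sub_norm_sq_eq_integral` is the chain rule for `‖η‖²` when `η` is a primitive of an
integrable function. -/

lemma cell_eq_prod (L : ℝ) :
    cell L = (volume.restrict (Ioo 0 L)).prod (volume.restrict (Ioo (0 : ℝ) 1)) := by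
  rw [cell, Measure.volume_eq_prod, Measure.prod_restrict]

instance isFiniteMeasure_cell (L : ℝ) : IsFiniteMeasure (cell L) := by
  rw [cell_eq_prod]; infer_instance

lemma ae_mem_cell (L : ℝ) : ∀ᵐ x ∂(cell L), x ∈ Ioo 0 L ×ˢ Ioo (0 : ℝ) 1 :=
  ae_restrict_mem (measurableSet_Ioo.prod measurableSet_Ioo)

lemma exists_bound_on_cell (L : ℝ) {F : ℝ × ℝ → ℝ} (hF : Continuous F) :
    ∃ C, ∀ᵐ x ∂(cell L), ‖F x‖ ≤ C := by
  obtain ⟨C, hC⟩ := (isCompact_Icc.prod isCompact_Icc : IsCompact (Icc 0 L ×ˢ Icc (0 : ℝ) 1)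
    ).exists_bound_of_continuousOn hF.continuousOn
  refine ⟨C, ?_⟩
  filter_upwards [ae_mem_cell L] with x hx
  exact hC x ⟨Ioo_subset_Icc_self hx.1, Ioo_subset_Icc_self hx.2⟩

lemma memLp_cell (L : ℝ) {F : ℝ × ℝ → ℝ} (hF : Continuous F) (p : ENNReal) :
    MemLp F p (cell L) := by
  obtain ⟨C, hC⟩ := exists_bound_on_cell L hF
  exact MemLp.of_bound hF.aestronglyMeasurable C hC

lemma integrable_cell (L : ℝ) {F : ℝ × ℝ → ℝ} (hF : Continuous F) : Integrable F (cell L) :=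
  memLp_one_iff_integrable.1 (memLp_cell L hF 1)

lemma setIntegral_Ioo_eq {a b : ℝ} (hab : a ≤ b) (f : ℝ → ℝ) :
    ∫ s in Ioo a b, f s = ∫ s in a..b, f s := by
  rw [intervalIntegral.integral_of_le hab, integral_Ioc_eq_integral_Ioo]

lemma integral_cell (L : ℝ) (hL : 0 < L) {F : ℝ × ℝ → ℝ} (hF : Integrable F (cell L)) :
    ∫ x, F x ∂(cell L) = ∫ s in (0 : ℝ)..L, ∫ y in (0 : ℝ)..1, F (s, y) := by
  rw [cell_eq_prod] at hF ⊢
  rw [integral_prod _ hF, setIntegral_Ioo_eq hL.le]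
  simp_rw [setIntegral_Ioo_eq zero_le_one]

lemma integral_cell_symm (L : ℝ) (hL : 0 < L) {F : ℝ × ℝ → ℝ} (hF : Integrable F (cell L)) :
    ∫ x, F x ∂(cell L) = ∫ y in (0 : ℝ)..1, ∫ s in (0 : ℝ)..L, F (s, y) := by
  rw [cell_eq_prod] at hF ⊢
  rw [integral_prod_symm _ hF, setIntegral_Ioo_eq zero_le_one]
  simp_rw [setIntegral_Ioo_eq hL.le]

/-! ### Classical fields on the channel -/

/-- `C¹` functions that match across `x₁ = 0` and `x₁ = L` and vanish on the walls. -/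
structure IsChannelField (L : ℝ) (φ : ℝ × ℝ → ℝ) : Prop where
  contDiff : ContDiff ℝ 1 φ
  periodic : ∀ y, φ (L, y) = φ (0, y)
  bottom : ∀ s, φ (s, 0) = 0
  top : ∀ s, φ (s, 1) = 0

lemma IsTest.contDiff {L : ℝ} {φ : ℝ × ℝ → ℝ} (h : IsTest L φ) : ContDiff ℝ ∞ φ := by
  obtain ⟨N, a, b, ha, hb, hφ⟩ := h
  rw [funext hφ]
  refine ContDiff.sum fun k _ => ?_
  have h1 := (ha k).1
  have h2 := (hb k).1
  fun_prop

lemma IsTest.isChannelField {L : ℝ} (hL : 0 < L) {φ : ℝ × ℝ → ℝ} (h : IsTest L φ) :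
    IsChannelField L φ := by
  refine ⟨h.contDiff.of_le (by norm_cast), ?_, ?_, ?_⟩ <;> obtain ⟨N, a, b, ha, hb, hφ⟩ := h
  · intro y
    rw [hφ, hφ]
    refine Finset.sum_congr rfl fun k _ => ?_
    have e : 2 * Real.pi * k * L / L = k * (2 * Real.pi) := by field_simp
    simp only [e, mul_zero, zero_div, Real.cos_nat_mul_two_pi, Real.cos_zero, Real.sin_zero]
    rw [show (k : ℝ) * (2 * Real.pi) = (2 * k : ℕ) * Real.pi by push_cast; ring,
      Real.sin_nat_mul_pi, mul_zero]
  all_goals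
    intro s
    rw [hφ]
    refine Finset.sum_eq_zero fun k _ => ?_
    rw [image_eq_zero_of_notMem_tsupport (f := a k) (fun h => by simpa using (ha k).2.2 h),
      image_eq_zero_of_notMem_tsupport (f := b k) (fun h => by simpa using (hb k).2.2 h)]
    ring

lemma continuous_pderiv {φ : ℝ × ℝ → ℝ} (h : ContDiff ℝ 1 φ) (j : Fin 2) :
    Continuous (pderiv j φ) := by
  unfold pderiv
  have := h.continuous_fderiv one_ne_zero
  fun_prop

lemma hasDerivAt_pderiv_zero {φ : ℝ × ℝ → ℝ} (h : ContDiff ℝ 1 φ) (s y : ℝ) :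
    HasDerivAt (fun s => φ (s, y)) (pderiv 0 φ (s, y)) s := by
  have h1 := (h.differentiable one_ne_zero (s, y)).hasFDerivAt
  exact h1.comp_hasDerivAt s ((hasDerivAt_id s).prodMk (hasDerivAt_const s y))

lemma hasDerivAt_pderiv_one {φ : ℝ × ℝ → ℝ} (h : ContDiff ℝ 1 φ) (s y : ℝ) :
    HasDerivAt (fun y => φ (s, y)) (pderiv 1 φ (s, y)) y := by
  have h1 := (h.differentiable one_ne_zero (s, y)).hasFDerivAt
  exact h1.comp_hasDerivAt y ((hasDerivAt_const y s).prodMk (hasDerivAt_id y))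

lemma pderiv_mul {φ ψ : ℝ × ℝ → ℝ} (hφ : ContDiff ℝ 1 φ) (hψ : ContDiff ℝ 1 ψ) (j : Fin 2)
    (x : ℝ × ℝ) :
    pderiv j (fun x => φ x * ψ x) x = φ x * pderiv j ψ x + ψ x * pderiv j φ x := by
  unfold pderiv
  rw [fderiv_fun_mul (hφ.differentiable one_ne_zero x) (hψ.differentiable one_ne_zero x)]
  simp

lemma IsChannelField.mul {L : ℝ} {φ ψ : ℝ × ℝ → ℝ} (hφ : IsChannelField L φ)
    (hψ : IsChannelField L ψ) : IsChannelField L (fun x => φ x * ψ x) where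
  contDiff := hφ.contDiff.mul hψ.contDiff
  periodic y := by simp only [hφ.periodic, hψ.periodic]
  bottom s := by simp only [hφ.bottom, zero_mul]
  top s := by simp only [hφ.top, zero_mul]

/-- Fubini with the variable of differentiation innermost, then the fundamental theorem of calculus:
the boundary terms cancel by periodicity for `j = 0` and vanish on the walls for `j = 1`. -/
lemma IsChannelField.integral_pderiv {L : ℝ} (hL : 0 < L) {φ : ℝ × ℝ → ℝ}
    (h : IsChannelField L φ) (j : Fin 2) : ∫ x, pderiv j φ x ∂(cell L) = 0 := by
  have hc := fun j => continuous_pderiv h.contDiff j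
  fin_cases j
  · change ∫ x, pderiv 0 φ x ∂(cell L) = 0
    rw [integral_cell_symm L hL (integrable_cell L (hc _))]
    refine (intervalIntegral.integral_congr fun y _ => ?_).trans intervalIntegral.integral_zero
    have h0 := hc 0
    rw [intervalIntegral.integral_eq_sub_of_hasDerivAt
      (fun s _ => hasDerivAt_pderiv_zero h.contDiff s y)
      (Continuous.intervalIntegrable (by fun_prop) _ _)]
    rw [h.periodic, sub_self]
  · change ∫ x, pderiv 1 φ x ∂(cell L) = 0
    rw [integral_cell L hL (integrable_cell L (hc _))]
    refine (intervalIntegral.integral_congr fun s _ => ?_).trans intervalIntegral.integral_zero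
    have h0 := hc 1
    rw [intervalIntegral.integral_eq_sub_of_hasDerivAt
      (fun y _ => hasDerivAt_pderiv_one h.contDiff s y)
      (Continuous.intervalIntegrable (by fun_prop) _ _)]
    rw [h.top, h.bottom, sub_self]

lemma IsChannelField.integral_mul_pderiv {L : ℝ} (hL : 0 < L) {φ ψ : ℝ × ℝ → ℝ}
    (hφ : IsChannelField L φ) (hψ : IsChannelField L ψ) (j : Fin 2) :
    ∫ x, φ x * pderiv j ψ x ∂(cell L) = -∫ x, pderiv j φ x * ψ x ∂(cell L) := by
  have h := (hφ.mul hψ).integral_pderiv hL j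
  have c1 := continuous_pderiv hφ.contDiff j
  have c2 := continuous_pderiv hψ.contDiff j
  have c3 := hφ.contDiff.continuous
  have c4 := hψ.contDiff.continuous
  simp_rw [pderiv_mul hφ.contDiff hψ.contDiff] at h
  rw [integral_add (integrable_cell L (by fun_prop)) (integrable_cell L (by fun_prop))] at h
  simp_rw [mul_comm (pderiv j φ _)]
  linarith

/-- A divergence-free classical field transports the square of a classical field conservatively. -/
lemma IsChannelField.integral_transport {L : ℝ} (hL : 0 < L) {u : Fin 2 → ℝ × ℝ → ℝ}
    {ψ : ℝ × ℝ → ℝ} (hu : ∀ j, IsChannelField L (u j)) (hdiv : ∀ x, ∑ j, pderiv j (u j) x = 0)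
    (hψ : IsChannelField L ψ) : ∑ j, ∫ x, u j x * (ψ x * pderiv j ψ x) ∂(cell L) = 0 := by
  -- Write `ψ ∂ⱼψ` as half of `∂ⱼ(ψ²)` and move the derivative onto `uⱼ`; the sum over `j` then
  -- contains the divergence.
  have key : ∀ j, ∫ x, u j x * (ψ x * pderiv j ψ x) ∂(cell L)
      = -(1 / 2) * ∫ x, pderiv j (u j) x * (ψ x * ψ x) ∂(cell L) := by
    intro j
    have h := (hu j).integral_mul_pderiv hL (hψ.mul hψ) j
    simp_rw [pderiv_mul hψ.contDiff hψ.contDiff] at h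
    rw [neg_mul, ← mul_neg, ← h, ← integral_const_mul]
    congr 1; ext x; ring
  have hc : ∀ j, Integrable (fun x => pderiv j (u j) x * (ψ x * ψ x)) (cell L) := fun j => by
    have c1 := continuous_pderiv (hu j).contDiff j
    have c3 := hψ.contDiff.continuous
    exact integrable_cell L (by fun_prop)
  simp_rw [key, ← Finset.mul_sum]
  rw [← integral_finsetSum _ fun j _ => hc j]
  simp_rw [← Finset.sum_mul, hdiv]
  simp

/-! ### One-dimensional estimates -/

/-- Cauchy–Schwarz for `∫ f'`, obtained by expanding `∫ (f' - c)² ≥ 0` over `[x, y]` with `c = (f y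
- f x) / T`. Taking `T` instead of `y - x` makes the bound uniform in the endpoints. -/
lemma sq_sub_le_integral_sq {T : ℝ} (hT : 0 < T) {f f' : ℝ → ℝ}
    (hf : ∀ x, HasDerivAt f (f' x) x) (hf' : Continuous f') {x y : ℝ} (hx : x ∈ Icc 0 T)
    (hy : y ∈ Icc 0 T) : (f y - f x) ^ 2 ≤ T * ∫ s in (0 : ℝ)..T, f' s ^ 2 := by
  wlog hxy : x ≤ y generalizing x y
  · rw [← neg_sq, neg_sub]; exact this hy hx (not_le.1 hxy).le
  have hD : ∫ s in x..y, f' s = f y - f x :=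
    intervalIntegral.integral_eq_sub_of_hasDerivAt (fun s _ => hf s) (hf'.intervalIntegrable _ _)
  set D := f y - f x
  set c := D / T
  have h0 : 0 ≤ ∫ s in x..y, (f' s - c) ^ 2 :=
    intervalIntegral.integral_nonneg hxy fun s _ => sq_nonneg _
  have h1 : ∫ s in x..y, (f' s - c) ^ 2
      = (∫ s in x..y, f' s ^ 2) - 2 * c * D + (y - x) * c ^ 2 := by
    rw [← hD, ← intervalIntegral.integral_const_mul,
      ← intervalIntegral.integral_sub (Continuous.intervalIntegrable (by fun_prop) _ _)
        (Continuous.intervalIntegrable (by fun_prop) _ _), ← smul_eq_mul (y - x),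
      ← intervalIntegral.integral_const,
      ← intervalIntegral.integral_add (Continuous.intervalIntegrable (by fun_prop) _ _)
        (Continuous.intervalIntegrable (by fun_prop) _ _)]
    congr 1; ext s; ring
  have h2 : ∫ s in x..y, f' s ^ 2 ≤ ∫ s in (0 : ℝ)..T, f' s ^ 2 :=
    intervalIntegral.integral_mono_interval hx.1 hxy hy.2
      (Eventually.of_forall fun s => sq_nonneg _) ((hf'.pow 2).intervalIntegrable _ _)
  have h3 : (y - x) * c ^ 2 ≤ T * c ^ 2 :=
    mul_le_mul_of_nonneg_right (by linarith [hx.1, hy.2]) (sq_nonneg _)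
  have h4 : T * c = D := mul_div_cancel₀ _ hT.ne'
  calc D ^ 2 = T * (2 * c * D - T * c ^ 2) := by rw [← h4]; ring
    _ ≤ T * ∫ s in (0 : ℝ)..T, f' s ^ 2 := mul_le_mul_of_nonneg_left (by linarith) hT.le

/-- Average `f(x)² ≤ 2 f(s)² + 2 (f(x) - f(s))²` over `s`. No boundary condition enters, so this
serves the periodic direction, where fields need not vanish anywhere. -/
lemma sq_le_integral_sq_add {T : ℝ} (hT : 0 < T) {f f' : ℝ → ℝ}
    (hf : ∀ x, HasDerivAt f (f' x) x) (hf' : Continuous f') {x : ℝ} (hx : x ∈ Icc 0 T) :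
    f x ^ 2 ≤ 2 / T * (∫ s in (0 : ℝ)..T, f s ^ 2) + 2 * T * ∫ s in (0 : ℝ)..T, f' s ^ 2 := by
  have hc : Continuous f := continuous_iff_continuousAt.2 fun x => (hf x).continuousAt
  set E := ∫ s in (0 : ℝ)..T, f' s ^ 2
  have h : ∫ _ in (0 : ℝ)..T, f x ^ 2 ≤ ∫ s in (0 : ℝ)..T, (2 * f s ^ 2 + 2 * (T * E)) := by
    refine intervalIntegral.integral_mono_on hT.le (by simp)
      (Continuous.intervalIntegrable (by fun_prop) _ _) fun s hs => ?_
    have := sq_sub_le_integral_sq hT hf hf' hs hx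
    nlinarith [sq_nonneg (f x - 2 * f s)]
  rw [intervalIntegral.integral_add (Continuous.intervalIntegrable (by fun_prop) _ _) (by simp),
    intervalIntegral.integral_const_mul] at h
  simp only [intervalIntegral.integral_const, smul_eq_mul, sub_zero] at h
  set I := ∫ s in (0 : ℝ)..T, f s ^ 2
  have : T * f x ^ 2 ≤ T * (2 / T * I + 2 * T * E) := by
    have : T * (2 / T * I + 2 * T * E) = 2 * I + T * (2 * (T * E)) := by field_simp
    linarith
  exact le_of_mul_le_mul_left this hT

/-! ### Two-dimensional estimates for classical fields -/

lemma IsChannelField.sq_le {L : ℝ} {φ : ℝ × ℝ → ℝ}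
    (h : IsChannelField L φ) {s y : ℝ} (hy : y ∈ Icc (0 : ℝ) 1) :
    φ (s, y) ^ 2 ≤ ∫ y in (0 : ℝ)..1, pderiv 1 φ (s, y) ^ 2 := by
  have hc := continuous_pderiv h.contDiff 1
  have := sq_sub_le_integral_sq one_pos (fun y => hasDerivAt_pderiv_one h.contDiff s y)
    (by fun_prop) (left_mem_Icc.2 zero_le_one) hy
  simpa [h.bottom] using this

lemma IsChannelField.sq_le' {L : ℝ} (hL : 0 < L) {φ : ℝ × ℝ → ℝ}
    (h : IsChannelField L φ) {s y : ℝ} (hs : s ∈ Icc 0 L) :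
    φ (s, y) ^ 2 ≤ ∫ s in (0 : ℝ)..L, (2 / L * φ (s, y) ^ 2 + 2 * L * pderiv 0 φ (s, y) ^ 2) := by
  have hc := continuous_pderiv h.contDiff 0
  have hc' := h.contDiff.continuous
  have := sq_le_integral_sq_add hL (fun s => hasDerivAt_pderiv_zero h.contDiff s y)
    (by fun_prop) hs
  rwa [intervalIntegral.integral_add (Continuous.intervalIntegrable (by fun_prop) _ _)
    (Continuous.intervalIntegrable (by fun_prop) _ _), intervalIntegral.integral_const_mul,
    intervalIntegral.integral_const_mul]

/-- Poincaré's inequality for classical fields. -/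
lemma IsChannelField.integral_sq_le {L : ℝ} (hL : 0 < L) {φ : ℝ × ℝ → ℝ}
    (h : IsChannelField L φ) :
    ∫ x, φ x ^ 2 ∂(cell L) ≤ ∫ x, pderiv 1 φ x ^ 2 ∂(cell L) := by
  have hc := continuous_pderiv h.contDiff 1
  have hc' := h.contDiff.continuous
  rw [integral_cell L hL (integrable_cell L (by fun_prop)),
    integral_cell L hL (integrable_cell L (by fun_prop))]
  refine intervalIntegral.integral_mono_on hL.le (Continuous.intervalIntegrable ?_ _ _)
    (Continuous.intervalIntegrable ?_ _ _) fun s hs => ?_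
  · exact intervalIntegral.continuous_parametric_intervalIntegral_of_continuous' (by fun_prop) _ _
  · exact intervalIntegral.continuous_parametric_intervalIntegral_of_continuous' (by fun_prop) _ _
  · calc _ ≤ ∫ y in (0 : ℝ)..1, ∫ y in (0 : ℝ)..1, pderiv 1 φ (s, y) ^ 2 :=
        intervalIntegral.integral_mono_on zero_le_one
          (Continuous.intervalIntegrable (by fun_prop) _ _) (by simp) fun y hy => h.sq_le hy
      _ = _ := by simp

/-- The product of two classical fields is controlled in `L²` by their `H¹` norms. -/
lemma IsChannelField.integral_sq_mul_sq_le {L : ℝ} (hL : 0 < L) {φ ψ : ℝ × ℝ → ℝ}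
    (hφ : IsChannelField L φ) (hψ : IsChannelField L ψ) :
    ∫ x, φ x ^ 2 * ψ x ^ 2 ∂(cell L) ≤
      (∫ x, (2 / L * φ x ^ 2 + 2 * L * pderiv 0 φ x ^ 2) ∂(cell L))
        * ∫ x, pderiv 1 ψ x ^ 2 ∂(cell L) := by
  have c1 := continuous_pderiv hφ.contDiff 0
  have c2 := continuous_pderiv hψ.contDiff 1
  have c3 := hφ.contDiff.continuous
  have c4 := hψ.contDiff.continuous
  rw [integral_cell_symm L hL (integrable_cell L (by fun_prop :
      Continuous fun x => 2 / L * φ x ^ 2 + 2 * L * pderiv 0 φ x ^ 2)),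
    integral_cell L hL (integrable_cell L (by fun_prop : Continuous fun x => pderiv 1 ψ x ^ 2)),
    integral_cell L hL (integrable_cell L (by fun_prop))]
  -- `h y` bounds `φ²` along the horizontal line at height `y`, and `g s` bounds `ψ²` along the
  -- vertical line at `s`. The integral of `h y * g s` over the cell factorises.
  set h : ℝ → ℝ := fun y => ∫ s in (0 : ℝ)..L, (2 / L * φ (s, y) ^ 2 + 2 * L * pderiv 0 φ (s, y) ^ 2)
  set g : ℝ → ℝ := fun s => ∫ y in (0 : ℝ)..1, pderiv 1 ψ (s, y) ^ 2
  have hh : Continuous h :=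
    intervalIntegral.continuous_parametric_intervalIntegral_of_continuous' (by fun_prop) _ _
  have hg : Continuous g :=
    intervalIntegral.continuous_parametric_intervalIntegral_of_continuous' (by fun_prop) _ _
  rw [← intervalIntegral.integral_const_mul]
  refine intervalIntegral.integral_mono_on hL.le (Continuous.intervalIntegrable
    (intervalIntegral.continuous_parametric_intervalIntegral_of_continuous' (by fun_prop) _ _) _ _)
    (Continuous.intervalIntegrable (by fun_prop) _ _) fun s hs => ?_
  rw [← intervalIntegral.integral_mul_const]
  refine intervalIntegral.integral_mono_on zero_le_one (Continuous.intervalIntegrable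
    (by fun_prop) _ _) (Continuous.intervalIntegrable (by fun_prop) _ _) fun y hy => ?_
  have := hφ.sq_le' hL (y := y) hs
  exact mul_le_mul this (hψ.sq_le hy) (sq_nonneg _) ((sq_nonneg _).trans this)

/-! ### Density of the test functions in `L²` -/

lemma ae_eq_zero_of_forall_integral_smooth_mul_eq_zero {a b : ℝ} {K : ℝ → ℝ}
    (hK : Integrable K (volume.restrict (Ioo a b)))
    (h : ∀ q : ℝ → ℝ, ContDiff ℝ ∞ q → HasCompactSupport q → tsupport q ⊆ Ioo a b →
      ∫ s in Ioo a b, q s * K s = 0) : K =ᵐ[volume.restrict (Ioo a b)] 0 := by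
  have := isOpen_Ioo.ae_eq_zero_of_integral_contDiff_smul_eq_zero (U := Ioo a b)
    (f := K) (μ := volume) (IntegrableOn.locallyIntegrableOn hK) fun q h1 h2 h3 => by
      rw [← h q h1 h2 h3]
      refine (setIntegral_eq_integral_of_forall_compl_eq_zero fun x hx => ?_).symm
      rw [image_eq_zero_of_notMem_tsupport fun h => hx (h3 h), zero_smul]
  exact (ae_restrict_iff' measurableSet_Ioo).2 this

lemma isTest_mul_cos (L : ℝ) (k : ℕ) {a : ℝ → ℝ} (h1 : ContDiff ℝ ∞ a)
    (h2 : HasCompactSupport a) (h3 : tsupport a ⊆ Ioo 0 1) :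
    IsTest L fun x => a x.2 * Real.cos (2 * Real.pi * k * x.1 / L) := by
  refine ⟨k, fun i => if i = k then a else 0, 0, fun i => ?_, fun i => ?_, fun x => ?_⟩
  · dsimp only
    split_ifs
    · exact ⟨h1, h2, h3⟩
    · exact ⟨contDiff_const, HasCompactSupport.zero, by simp⟩
  · exact ⟨contDiff_const, HasCompactSupport.zero, by simp⟩
  · rw [Finset.sum_eq_single k (fun i _ hi => by simp [hi]) (by simp)]
    simp

lemma isTest_mul_sin (L : ℝ) (k : ℕ) {a : ℝ → ℝ} (h1 : ContDiff ℝ ∞ a)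
    (h2 : HasCompactSupport a) (h3 : tsupport a ⊆ Ioo 0 1) :
    IsTest L fun x => a x.2 * Real.sin (2 * Real.pi * k * x.1 / L) := by
  refine ⟨k, 0, fun i => if i = k then a else 0, fun i => ?_, fun i => ?_, fun x => ?_⟩
  · exact ⟨contDiff_const, HasCompactSupport.zero, by simp⟩
  · dsimp only
    split_ifs
    · exact ⟨h1, h2, h3⟩
    · exact ⟨contDiff_const, HasCompactSupport.zero, by simp⟩
  · rw [Finset.sum_eq_single k (fun i _ hi => by simp [hi]) (by simp)]
    simp

/-- A density on the cell whose moments against all trigonometric monomials vanish is orthogonal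
to all periodic continuous functions of `x₁`. -/
lemma integral_mul_periodic_eq_zero {L : ℝ} [hL : Fact (0 < L)] {μ : Measure (ℝ × ℝ)}
    {r : ℝ × ℝ → ℝ} (hr : Integrable r μ)
    (hcos : ∀ k : ℕ, ∫ x, r x * Real.cos (2 * Real.pi * k * x.1 / L) ∂μ = 0)
    (hsin : ∀ k : ℕ, ∫ x, r x * Real.sin (2 * Real.pi * k * x.1 / L) ∂μ = 0)
    (p : C(AddCircle L, ℂ)) : ∫ x, (r x : ℂ) * p (x.1 : AddCircle L) ∂μ = 0 := by
  have hrc : Integrable (fun x => (r x : ℂ)) μ := hr.ofReal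
  have hint : ∀ p : C(AddCircle L, ℂ), Integrable (fun x => (r x : ℂ) * p (x.1 : AddCircle L)) μ :=
    fun p => hrc.mul_bdd (c := ‖p‖)
      (Continuous.aestronglyMeasurable
        (p.continuous.comp ((AddCircle.continuous_mk' L).comp continuous_fst)))
      (Eventually.of_forall fun x => p.norm_coe_le_norm _)
  -- Integration against `r` is a bounded functional in the sup norm, so it vanishes as soon as it
  -- kills the Fourier monomials, whose span is dense.
  let Λ : C(AddCircle L, ℂ) →L[ℂ] ℂ := LinearMap.mkContinuous
    { toFun := fun p => ∫ x, (r x : ℂ) * p (x.1 : AddCircle L) ∂μ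
      map_add' := fun p q => by
        rw [← integral_add (hint p) (hint q)]
        simp [mul_add]
      map_smul' := fun c p => by
        simp only [ContinuousMap.smul_apply, smul_eq_mul, RingHom.id_apply]
        rw [← integral_const_mul]
        congr 1; ext x; ring } (∫ x, ‖r x‖ ∂μ) fun p => by
      simp only [LinearMap.coe_mk, AddHom.coe_mk]
      rw [← integral_mul_const]
      refine norm_integral_le_of_norm_le (hr.norm.mul_const _) (Eventually.of_forall fun x => ?_)
      rw [norm_mul, Complex.norm_real]
      exact mul_le_mul_of_nonneg_left (p.norm_coe_le_norm _) (norm_nonneg _)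
  have hΛ : Λ = 0 := by
    refine ContinuousLinearMap.ext_on (s := range (@fourier L)) ?_ ?_
    · rw [dense_iff_closure_eq, ← Submodule.topologicalClosure_coe, span_fourier_closure_eq_top]
      rfl
    · rintro _ ⟨n, rfl⟩
      change ∫ x, (r x : ℂ) * fourier n (x.1 : AddCircle L) ∂μ = 0
      have hkey : ∀ σ : ℝ, ∀ k : ℕ, (σ = 1 ∨ σ = -1) → ((n : ℝ) = σ * k) →
          ∫ x, (r x : ℂ) * fourier n (x.1 : AddCircle L) ∂μ = 0 := by
        intro σ k hσ hn
        have e : ∀ x : ℝ × ℝ, (r x : ℂ) * fourier n (x.1 : AddCircle L)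
            = ((r x * Real.cos (2 * Real.pi * k * x.1 / L) : ℝ) : ℂ)
              + (σ * Complex.I) * ((r x * Real.sin (2 * Real.pi * k * x.1 / L) : ℝ) : ℂ) := by
          intro x
          rw [fourier_coe_apply]
          have e1 : 2 * Real.pi * Complex.I * n * x.1 / L
              = ((σ * (2 * Real.pi * k * x.1 / L) : ℝ) : ℂ) * Complex.I := by
            have : (n : ℂ) = ((n : ℝ) : ℂ) := by simp
            rw [this, hn]; push_cast; ring
          rw [e1, Complex.exp_mul_I, ← Complex.ofReal_cos, ← Complex.ofReal_sin]
          rcases hσ with rfl | rfl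
          · simp only [one_mul]; push_cast; ring
          · simp only [neg_mul, one_mul, Real.cos_neg, Real.sin_neg]; push_cast; ring
        have i1 : Integrable (fun x => r x * Real.cos (2 * Real.pi * k * x.1 / L)) μ :=
          hr.mul_bdd (c := 1) (Continuous.aestronglyMeasurable (by fun_prop))
            (Eventually.of_forall fun x => Real.abs_cos_le_one _)
        have i2 : Integrable (fun x => r x * Real.sin (2 * Real.pi * k * x.1 / L)) μ :=
          hr.mul_bdd (c := 1) (Continuous.aestronglyMeasurable (by fun_prop))
            (Eventually.of_forall fun x => Real.abs_sin_le_one _)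
        simp_rw [e]
        rw [integral_add i1.ofReal (i2.ofReal.const_mul _), integral_const_mul,
          integral_complex_ofReal, integral_complex_ofReal, hcos, hsin]
        simp
      rcases Int.eq_nat_or_neg n with ⟨k, hk | hk⟩
      · exact hkey 1 k (Or.inl rfl) (by simp [hk])
      · exact hkey (-1) k (Or.inr rfl) (by simp [hk])
  exact DFunLike.congr_fun hΛ p

/-- Since `p` vanishes at `0` and `L`, it extends to a continuous function on the circle, hence is a
uniform limit of trigonometric polynomials; times `a`, these are covered by `h`. -/
lemma integral_mul_smooth_mul_smooth_eq_zero {L : ℝ} (hL : 0 < L) {g : ℝ × ℝ → ℝ}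
    (hg : Integrable g (cell L)) (h : ∀ φ, IsTest L φ → ∫ x, g x * φ x ∂(cell L) = 0)
    {a p : ℝ → ℝ} (ha1 : ContDiff ℝ ∞ a) (ha2 : HasCompactSupport a) (ha3 : tsupport a ⊆ Ioo 0 1)
    (hp1 : Continuous p) (hp3 : tsupport p ⊆ Ioo 0 L) :
    ∫ x, g x * a x.2 * p x.1 ∂(cell L) = 0 := by
  have : Fact (0 < L) := ⟨hL⟩
  obtain ⟨C, hC⟩ := ha2.exists_bound_of_continuous ha1.continuous
  have ha := ha1.continuous
  have hr : Integrable (fun x : ℝ × ℝ => g x * a x.2) (cell L) :=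
    hg.mul_bdd (c := C) (Continuous.aestronglyMeasurable (by fun_prop))
      (Eventually.of_forall fun x => hC _)
  have hcont : Continuous (AddCircle.liftIco L 0 fun s => (p s : ℂ)) := by
    refine AddCircle.liftIco_zero_continuous ?_ (Continuous.continuousOn (by fun_prop))
    rw [image_eq_zero_of_notMem_tsupport (f := p) (fun h => by simpa using hp3 h),
      image_eq_zero_of_notMem_tsupport (f := p) (fun h => by simpa using hp3 h)]
  have key := integral_mul_periodic_eq_zero hr
    (fun k => by simpa only [mul_assoc] using h _ (isTest_mul_cos L k ha1 ha2 ha3))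
    (fun k => by simpa only [mul_assoc] using h _ (isTest_mul_sin L k ha1 ha2 ha3)) ⟨_, hcont⟩
  have e : ∫ x, ((g x * a x.2 : ℝ) : ℂ) *
      AddCircle.liftIco L 0 (fun s => (p s : ℂ)) (x.1 : AddCircle L) ∂(cell L)
      = ∫ x, ((g x * a x.2 * p x.1 : ℝ) : ℂ) ∂(cell L) := by
    refine integral_congr_ae ?_
    filter_upwards [ae_mem_cell L] with x hx
    rw [AddCircle.liftIco_zero_coe_apply ⟨hx.1.1.le, hx.1.2⟩]
    push_cast; ring
  rw [integral_complex_ofReal] at e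
  exact_mod_cast e.symm.trans key

/-- Products `a(x₂) p(x₁)` suffice: freeing one variable at a time with the one-dimensional lemma
replaces `a`, then `p`, by indicators of measurable sets. Thus `g` has zero integral over
rectangles, and a π-λ argument reaches every measurable set. -/
lemma ae_eq_zero_of_forall_test {L : ℝ} (hL : 0 < L) {g : ℝ × ℝ → ℝ}
    (hg : Integrable g (cell L)) (h : ∀ φ, IsTest L φ → ∫ x, g x * φ x ∂(cell L) = 0) :
    g =ᵐ[cell L] 0 := by
  set μ₁ := volume.restrict (Ioo 0 L)
  set μ₂ := volume.restrict (Ioo (0 : ℝ) 1)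
  have hprod : cell L = μ₁.prod μ₂ := cell_eq_prod L
  have h1 : ∀ p : ℝ → ℝ, ContDiff ℝ ∞ p → HasCompactSupport p → tsupport p ⊆ Ioo 0 L →
      ∀ t, MeasurableSet t → ∫ x in univ ×ˢ t, g x * p x.1 ∂(μ₁.prod μ₂) = 0 := by
    intro p hp1 hp2 hp3 t ht
    obtain ⟨C, hC⟩ := hp2.exists_bound_of_continuous hp1.continuous
    have hp := hp1.continuous
    have hgp : Integrable (fun x : ℝ × ℝ => g x * p x.1) (μ₁.prod μ₂) := by
      rw [← hprod]
      exact hg.mul_bdd (c := C) (Continuous.aestronglyMeasurable (by fun_prop))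
        (Eventually.of_forall fun x => hC _)
    have h0 : (fun y => ∫ s, g (s, y) * p s ∂μ₁) =ᵐ[μ₂] 0 := by
      refine ae_eq_zero_of_forall_integral_smooth_mul_eq_zero hgp.integral_prod_right ?_
      intro a ha1 ha2 ha3
      have := integral_mul_smooth_mul_smooth_eq_zero hL hg h ha1 ha2 ha3 hp hp3
      obtain ⟨C', hC'⟩ := ha2.exists_bound_of_continuous ha1.continuous
      have ha := ha1.continuous
      have hgpa : Integrable (fun x : ℝ × ℝ => (g x * p x.1) * a x.2) (μ₁.prod μ₂) :=
        hgp.mul_bdd (c := C') (Continuous.aestronglyMeasurable (by fun_prop))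
          (Eventually.of_forall fun x => hC' _)
      simp_rw [mul_right_comm _ (a _)] at this
      rw [hprod, integral_prod_symm _ hgpa] at this
      simpa only [integral_mul_const, mul_comm (a _)] using this
    rw [← Measure.prod_restrict, Measure.restrict_univ, integral_prod_symm]
    · exact (integral_congr_ae (ae_restrict_of_ae h0)).trans (by simp)
    · have := hgp.restrict (s := univ ×ˢ t)
      rwa [← Measure.prod_restrict, Measure.restrict_univ] at this
  have hg' : Integrable g (μ₁.prod μ₂) := hprod ▸ hg
  have h2 : ∀ s t, MeasurableSet s → MeasurableSet t → ∫ x in s ×ˢ t, g x ∂(μ₁.prod μ₂) = 0 := by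
    intro s t hs ht
    have hgt : Integrable g (μ₁.prod (μ₂.restrict t)) := by
      have := hg'.restrict (s := univ ×ˢ t)
      rwa [← Measure.prod_restrict, Measure.restrict_univ] at this
    have h0 : (fun s => ∫ y in t, g (s, y) ∂μ₂) =ᵐ[μ₁] 0 := by
      refine ae_eq_zero_of_forall_integral_smooth_mul_eq_zero hgt.integral_prod_left ?_
      intro p hp1 hp2 hp3
      have := h1 p hp1 hp2 hp3 t ht
      obtain ⟨C, hC⟩ := hp2.exists_bound_of_continuous hp1.continuous
      have hp := hp1.continuous
      rw [← Measure.prod_restrict, Measure.restrict_univ, integral_prod] at this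
      · simpa only [integral_mul_const, mul_comm (p _)] using this
      · exact hgt.mul_bdd (c := C) (Continuous.aestronglyMeasurable (by fun_prop))
          (Eventually.of_forall fun x => hC _)
    have hgst := hg'.restrict (s := s ×ˢ t)
    rw [← Measure.prod_restrict] at hgst ⊢
    rw [integral_prod _ hgst]
    exact (integral_congr_ae (ae_restrict_of_ae h0)).trans (by simp)
  rw [hprod]
  refine hg'.ae_eq_zero_of_forall_setIntegral_eq_zero fun s hs _ => ?_
  induction s, hs using MeasurableSpace.induction_on_inter generateFrom_prod.symm
    isPiSystem_prod with
  | empty => simp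
  | basic s hs =>
    obtain ⟨a, ha, b, hb, rfl⟩ := hs
    exact h2 a b ha hb
  | compl s hs ih =>
    have h3 := h2 univ univ MeasurableSet.univ MeasurableSet.univ
    rw [univ_prod_univ, setIntegral_univ, ← integral_add_compl hs hg', ih (measure_lt_top _ _), zero_add] at h3
    exact h3
  | iUnion f hd hm ih =>
    rw [integral_iUnion hm hd hg'.integrableOn]
    simp [ih]

/-! ### `L²` bookkeeping -/

lemma inner_scal {L : ℝ} (f g : Scal L) : inner ℝ f g = ∫ x, f x * g x ∂(cell L) := by
  rw [L2.inner_def]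
  simp [mul_comm]

lemma inner_scal_congr {L : ℝ} {f g : Scal L} {F G : ℝ × ℝ → ℝ} (hf : f =ᵐ[cell L] F)
    (hg : g =ᵐ[cell L] G) : inner ℝ f g = ∫ x, F x * G x ∂(cell L) := by
  rw [inner_scal]
  refine integral_congr_ae ?_
  filter_upwards [hf, hg] with x h1 h2
  rw [h1, h2]

lemma norm_sq_scal_congr {L : ℝ} {f : Scal L} {F : ℝ × ℝ → ℝ} (hf : f =ᵐ[cell L] F) :
    ‖f‖ ^ 2 = ∫ x, F x ^ 2 ∂(cell L) := by
  rw [← real_inner_self_eq_norm_sq, inner_scal_congr hf hf]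
  simp_rw [sq]

/-- The class of a continuous function in `L²(Ω)`. -/
noncomputable def ofContinuous (L : ℝ) (F : ℝ × ℝ → ℝ) (hF : Continuous F) : Scal L :=
  (memLp_cell L hF 2).toLp F

lemma ofContinuous_ae (L : ℝ) (F : ℝ × ℝ → ℝ) (hF : Continuous F) :
    ofContinuous L F hF =ᵐ[cell L] F := (memLp_cell L hF 2).coeFn_toLp

lemma integrable_scal {L : ℝ} (f : Scal L) : Integrable f (cell L) :=
  (Lp.memLp f).integrable (by norm_num)

lemma integrable_scal_mul {L : ℝ} (f g : Scal L) : Integrable (fun x => f x * g x) (cell L) :=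
  (Lp.memLp f).integrable_mul (Lp.memLp g)

/-- Fatou's lemma. It carries product estimates from test functions to `V₁`, where the product is
not known in advance to be in `L²`. -/
lemma exists_scal_of_tendsto_ae {L : ℝ} {P : ℕ → Scal L} {B : ℕ → ℝ} {b : ℝ} {F : ℝ × ℝ → ℝ}
    (hae : ∀ᵐ x ∂(cell L), Tendsto (fun n => P n x) atTop (𝓝 (F x))) (hB : ∀ n, ‖P n‖ ≤ B n)
    (hb : Tendsto B atTop (𝓝 b)) : ∃ Q : Scal L, Q =ᵐ[cell L] F ∧ ‖Q‖ ≤ b := by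
  have hm : ∀ n, AEStronglyMeasurable (P n) (cell L) := fun n => Lp.aestronglyMeasurable _
  have hFm : AEStronglyMeasurable F (cell L) := aestronglyMeasurable_of_tendsto_ae _ hm hae
  have hb0 : 0 ≤ b := ge_of_tendsto' hb fun n => (norm_nonneg _).trans (hB n)
  have h1 : eLpNorm F 2 (cell L) ≤ ENNReal.ofReal b := by
    refine (Lp.eLpNorm_lim_le_liminf_eLpNorm hm F hae).trans ?_
    rw [← ((ENNReal.continuous_ofReal.tendsto b).comp hb).liminf_eq]
    refine liminf_le_liminf (Eventually.of_forall fun n => ?_)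
    change _ ≤ ENNReal.ofReal (B n)
    rw [← ENNReal.ofReal_toReal (Lp.eLpNorm_ne_top (P n)), ← Lp.norm_def]
    exact ENNReal.ofReal_le_ofReal (hB n)
  have h2 : MemLp F 2 (cell L) := ⟨hFm, h1.trans_lt ENNReal.ofReal_lt_top⟩
  refine ⟨h2.toLp F, h2.coeFn_toLp, ?_⟩
  rw [Lp.norm_toLp]
  exact ENNReal.toReal_le_of_le_ofReal hb0 h1

/-! ### Weak derivatives -/

lemma scal_eq_zero_of_forall_test {L : ℝ} (hL : 0 < L) {g : Scal L}
    (h : ∀ φ, IsTest L φ → ∫ x, g x * φ x ∂(cell L) = 0) : g = 0 :=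
  (Lp.eq_zero_iff_ae_eq_zero).2 (ae_eq_zero_of_forall_test hL (integrable_scal g) h)

lemma integrable_scal_mul_continuous {L : ℝ} (f : Scal L) {F : ℝ × ℝ → ℝ} (hF : Continuous F) :
    Integrable (fun x => f x * F x) (cell L) :=
  (Lp.memLp f).integrable_mul (memLp_cell L hF 2)

lemma integral_sub_mul_continuous {L : ℝ} (f g : Scal L) {F : ℝ × ℝ → ℝ} (hF : Continuous F) :
    ∫ x, (f - g : Scal L) x * F x ∂(cell L)
      = ∫ x, f x * F x ∂(cell L) - ∫ x, g x * F x ∂(cell L) := by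
  rw [← integral_sub (integrable_scal_mul_continuous f hF) (integrable_scal_mul_continuous g hF)]
  refine integral_congr_ae ?_
  filter_upwards [Lp.coeFn_sub f g] with x hx
  rw [hx, Pi.sub_apply, sub_mul]

lemma IsTest.contDiff_one {L : ℝ} {φ : ℝ × ℝ → ℝ} (h : IsTest L φ) : ContDiff ℝ 1 φ :=
  h.contDiff.of_le (by norm_cast)

lemma HasWeakDeriv.sub {L : ℝ} {j : Fin 2} {f₁ f₂ g₁ g₂ : Scal L} (h₁ : HasWeakDeriv L j f₁ g₁)
    (h₂ : HasWeakDeriv L j f₂ g₂) : HasWeakDeriv L j (f₁ - f₂) (g₁ - g₂) := by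
  intro φ hφ
  rw [integral_sub_mul_continuous _ _ (continuous_pderiv hφ.contDiff_one j),
    integral_sub_mul_continuous _ _ hφ.contDiff.continuous, h₁ φ hφ, h₂ φ hφ]
  ring

/-- The difference is orthogonal to `𝓕`, hence zero. The choice made in `weakDeriv` is therefore
harmless. -/
lemma HasWeakDeriv.unique {L : ℝ} (hL : 0 < L) {j : Fin 2} {f g₁ g₂ : Scal L}
    (h₁ : HasWeakDeriv L j f g₁) (h₂ : HasWeakDeriv L j f g₂) : g₁ = g₂ := by
  refine sub_eq_zero.1 (scal_eq_zero_of_forall_test hL fun φ hφ => ?_)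
  rw [integral_sub_mul_continuous _ _ hφ.contDiff.continuous]
  linarith [h₁ φ hφ, h₂ φ hφ]

lemma hasWeakDeriv_weakDeriv {L : ℝ} {f : Scal L} (hf : f ∈ sobolev1 L) (j : Fin 2) :
    HasWeakDeriv L j f (weakDeriv L j f) := by
  rw [weakDeriv, dif_pos (hf j)]
  exact (hf j).choose_spec

lemma HasWeakDeriv.weakDeriv_eq {L : ℝ} (hL : 0 < L) {j : Fin 2} {f g : Scal L}
    (h : HasWeakDeriv L j f g) : weakDeriv L j f = g := by
  have h' : ∃ g, HasWeakDeriv L j f g := ⟨g, h⟩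
  rw [weakDeriv, dif_pos h']
  exact h'.choose_spec.unique hL h

lemma sobolev1_sub {L : ℝ} {f g : Scal L} (hf : f ∈ sobolev1 L) (hg : g ∈ sobolev1 L) :
    f - g ∈ sobolev1 L :=
  fun j => ⟨_, (hasWeakDeriv_weakDeriv hf j).sub (hasWeakDeriv_weakDeriv hg j)⟩

lemma weakDeriv_sub {L : ℝ} (hL : 0 < L) {f g : Scal L} (hf : f ∈ sobolev1 L)
    (hg : g ∈ sobolev1 L) (j : Fin 2) :
    weakDeriv L j (f - g) = weakDeriv L j f - weakDeriv L j g :=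
  ((hasWeakDeriv_weakDeriv hf j).sub (hasWeakDeriv_weakDeriv hg j)).weakDeriv_eq hL

lemma IsChannelField.hasWeakDeriv {L : ℝ} (hL : 0 < L) {φ : ℝ × ℝ → ℝ} (h : IsChannelField L φ)
    {f g : Scal L} (hf : f =ᵐ[cell L] φ) {j : Fin 2} (hg : g =ᵐ[cell L] pderiv j φ) :
    HasWeakDeriv L j f g := by
  intro ψ hψ
  have e := h.integral_mul_pderiv hL (hψ.isChannelField hL) j
  rw [integral_congr_ae (hf.mono fun x hx => by simp only [hx] :
      (fun x => f x * pderiv j ψ x) =ᵐ[cell L] fun x => φ x * pderiv j ψ x),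
    integral_congr_ae (hg.mono fun x hx => by simp only [hx] :
      (fun x => g x * ψ x) =ᵐ[cell L] fun x => pderiv j φ x * ψ x), e]

lemma IsChannelField.mem_sobolev1 {L : ℝ} (hL : 0 < L) {φ : ℝ × ℝ → ℝ} (h : IsChannelField L φ)
    {f : Scal L} (hf : f =ᵐ[cell L] φ) : f ∈ sobolev1 L := fun j =>
  ⟨_, h.hasWeakDeriv hL hf (ofContinuous_ae L _ (continuous_pderiv h.contDiff j))⟩

lemma IsChannelField.weakDeriv_ae {L : ℝ} (hL : 0 < L) {φ : ℝ × ℝ → ℝ} (h : IsChannelField L φ)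
    {f : Scal L} (hf : f =ᵐ[cell L] φ) (j : Fin 2) :
    weakDeriv L j f =ᵐ[cell L] pderiv j φ := by
  rw [(h.hasWeakDeriv hL hf
    (ofContinuous_ae L _ (continuous_pderiv h.contDiff j))).weakDeriv_eq hL]
  exact ofContinuous_ae L _ _

/-! ### The space `V₁` -/

lemma IsTest.sub {L : ℝ} {φ ψ : ℝ × ℝ → ℝ} (hφ : IsTest L φ) (hψ : IsTest L ψ) :
    IsTest L fun x => φ x - ψ x := by
  obtain ⟨N, a, b, ha, hb, hφ⟩ := hφ
  obtain ⟨M, c, d, hc, hd, hψ⟩ := hψ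
  have key : ∀ a c : ℕ → ℝ → ℝ,
      (∀ k, ContDiff ℝ ∞ (a k) ∧ HasCompactSupport (a k) ∧ tsupport (a k) ⊆ Ioo 0 1) →
      (∀ k, ContDiff ℝ ∞ (c k) ∧ HasCompactSupport (c k) ∧ tsupport (c k) ⊆ Ioo 0 1) →
      ∀ k, ContDiff ℝ ∞ ((if k < N + 1 then a k else 0) - (if k < M + 1 then c k else 0)) ∧
        HasCompactSupport ((if k < N + 1 then a k else 0) - (if k < M + 1 then c k else 0)) ∧
        tsupport ((if k < N + 1 then a k else 0) - (if k < M + 1 then c k else 0)) ⊆ Ioo 0 1 := by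
    intro a c ha hc k
    have h1 : ∀ (p : Prop) [Decidable p] (f : ℝ → ℝ),
        (ContDiff ℝ ∞ f ∧ HasCompactSupport f ∧ tsupport f ⊆ Ioo 0 1) →
        (ContDiff ℝ ∞ (if p then f else 0) ∧ HasCompactSupport (if p then f else 0) ∧
          tsupport (if p then f else 0) ⊆ Ioo 0 1) := by
      intro p _ f hf
      split_ifs
      · exact hf
      · exact ⟨contDiff_const, HasCompactSupport.zero, by simp⟩
    obtain ⟨p1, p2, p3⟩ := h1 (k < N + 1) (a k) (ha k)
    obtain ⟨q1, q2, q3⟩ := h1 (k < M + 1) (c k) (hc k)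
    exact ⟨p1.sub q1, p2.sub q2, (tsupport_sub _ _).trans (union_subset p3 q3)⟩
  refine ⟨max N M, _, _, key a c ha hc, key b d hb hd, fun x => ?_⟩
  -- Extending both coefficient families by zero gives the two polynomials the same degree bound.
  have pad : ∀ (K : ℕ) (F : ℕ → ℝ), K ≤ max N M → ∑ k ∈ Finset.range (K + 1), F k
      = ∑ k ∈ Finset.range (max N M + 1), if k < K + 1 then F k else 0 := by
    intro K F hK
    rw [← Finset.sum_filter]
    congr 1
    ext k
    simp only [Finset.mem_range, Finset.mem_filter]
    omega
  simp only [hφ, hψ]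
  rw [pad N _ (le_max_left _ _), pad M _ (le_max_right _ _), ← Finset.sum_sub_distrib]
  refine Finset.sum_congr rfl fun k _ => ?_
  simp only [Pi.sub_apply]
  split_ifs <;> (try simp only [Pi.zero_apply]) <;> ring

lemma testScal_sub {L : ℝ} {f g : Scal L} (hf : f ∈ testScal L) (hg : g ∈ testScal L) :
    f - g ∈ testScal L := by
  obtain ⟨φ, hφ, hfφ⟩ := hf
  obtain ⟨ψ, hψ, hgψ⟩ := hg
  exact ⟨_, hφ.sub hψ, (Lp.coeFn_sub f g).trans (hfφ.sub hgψ)⟩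

lemma testScal_subset_sobolev1 {L : ℝ} (hL : 0 < L) : testScal L ⊆ sobolev1 L := by
  rintro f ⟨φ, hφ, hf⟩
  exact (hφ.isChannelField hL).mem_sobolev1 hL hf

/-- Elements of `V₁` are the limits in `H¹` of sequences of test functions. -/
lemma mem_V1_iff {L : ℝ} {f : Scal L} : f ∈ V1 L ↔ f ∈ sobolev1 L ∧
    ∃ F : ℕ → Scal L, (∀ n, F n ∈ testScal L) ∧ Tendsto F atTop (𝓝 f) ∧
      ∀ j, Tendsto (fun n => weakDeriv L j (F n)) atTop (𝓝 (weakDeriv L j f)) := by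
  refine and_congr_right fun _ => ?_
  rw [mem_closure_iff_seq_limit]
  constructor
  · rintro ⟨x, hx, hlim⟩
    choose F hF hFx using hx
    obtain rfl : (fun n => jetScal L (F n)) = x := funext hFx
    rw [Prod.tendsto_iff] at hlim
    exact ⟨F, hF, hlim.1, tendsto_pi_nhds.1 hlim.2⟩
  · rintro ⟨F, hF, h1, h2⟩
    exact ⟨fun n => jetScal L (F n), fun n => mem_image_of_mem _ (hF n),
      h1.prodMk_nhds (tendsto_pi_nhds.2 h2)⟩

lemma testScal_subset_V1 {L : ℝ} (hL : 0 < L) : testScal L ⊆ V1 L := fun f hf =>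
  mem_V1_iff.2 ⟨testScal_subset_sobolev1 hL hf, fun _ => f, fun _ => hf, tendsto_const_nhds,
    fun _ => tendsto_const_nhds⟩

lemma V1_sub {L : ℝ} (hL : 0 < L) {f g : Scal L} (hf : f ∈ V1 L) (hg : g ∈ V1 L) :
    f - g ∈ V1 L := by
  obtain ⟨hf1, F, hF, hF1, hF2⟩ := mem_V1_iff.1 hf
  obtain ⟨hg1, G, hG, hG1, hG2⟩ := mem_V1_iff.1 hg
  refine mem_V1_iff.2 ⟨sobolev1_sub hf1 hg1, fun n => F n - G n,
    fun n => testScal_sub (hF n) (hG n), hF1.sub hG1, fun j => ?_⟩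
  simp_rw [fun n => weakDeriv_sub hL (testScal_subset_sobolev1 hL (hF n))
    (testScal_subset_sobolev1 hL (hG n)) j, weakDeriv_sub hL hf1 hg1]
  exact (hF2 j).sub (hG2 j)

/-- Poincaré's inequality in `V₁`. -/
lemma norm_sq_le_of_mem_V1 {L : ℝ} (hL : 0 < L) {f : Scal L} (hf : f ∈ V1 L) :
    ‖f‖ ^ 2 ≤ ‖weakDeriv L 1 f‖ ^ 2 := by
  obtain ⟨_, F, hF, hF1, hF2⟩ := mem_V1_iff.1 hf
  refine le_of_tendsto_of_tendsto' (hF1.norm.pow 2) ((hF2 1).norm.pow 2) fun n => ?_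
  obtain ⟨φ, hφ, hFφ⟩ := hF n
  have hc := hφ.isChannelField hL
  rw [norm_sq_scal_congr hFφ, norm_sq_scal_congr (hc.weakDeriv_ae hL hFφ 1)]
  exact hc.integral_sq_le hL

lemma exists_mul_of_mem_testScal {L : ℝ} (hL : 0 < L) {f g : Scal L} (hf : f ∈ testScal L)
    (hg : g ∈ testScal L) : ∃ P : Scal L, (P =ᵐ[cell L] fun x => f x * g x) ∧
      ‖P‖ ≤ √(2 / L * ‖f‖ ^ 2 + 2 * L * ‖weakDeriv L 0 f‖ ^ 2) * ‖weakDeriv L 1 g‖ := by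
  obtain ⟨φ, hφ, hfφ⟩ := hf
  obtain ⟨ψ, hψ, hgψ⟩ := hg
  have hc := hφ.isChannelField hL
  have hd := hψ.isChannelField hL
  have c1 := hc.contDiff.continuous
  have c2 := hd.contDiff.continuous
  have c3 := continuous_pderiv hc.contDiff 0
  have hP := ofContinuous_ae L (fun x => φ x * ψ x) (by fun_prop)
  refine ⟨_, hP.trans (hfφ.mul hgψ).symm, ?_⟩
  have e := hc.integral_sq_mul_sq_le hL hd
  rw [integral_add (integrable_cell L (by fun_prop)) (integrable_cell L (by fun_prop)),
    integral_const_mul, integral_const_mul] at e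
  refine abs_le_of_sq_le_sq' ?_ (by positivity) |>.2
  rw [mul_pow, Real.sq_sqrt (by positivity), norm_sq_scal_congr hP, norm_sq_scal_congr hfφ,
    norm_sq_scal_congr (hc.weakDeriv_ae hL hfφ 0), norm_sq_scal_congr (hd.weakDeriv_ae hL hgψ 1)]
  simpa only [mul_pow] using e

/-- The product of two elements of `V₁` is in `L²`, and bounded by their `H¹` norms. -/
lemma exists_mul_of_mem_V1 {L : ℝ} (hL : 0 < L) {f g : Scal L} (hf : f ∈ V1 L)
    (hg : g ∈ V1 L) : ∃ P : Scal L, (P =ᵐ[cell L] fun x => f x * g x) ∧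
      ‖P‖ ≤ √(2 / L * ‖f‖ ^ 2 + 2 * L * ‖weakDeriv L 0 f‖ ^ 2) * ‖weakDeriv L 1 g‖ := by
  obtain ⟨_, F, hF, hF1, hF2⟩ := mem_V1_iff.1 hf
  obtain ⟨_, G, hG, hG1, hG2⟩ := mem_V1_iff.1 hg
  choose P hP hPB using fun n => exists_mul_of_mem_testScal hL (hF n) (hG n)
  -- Two successive extractions give a common subsequence along which `F` and `G`, hence their
  -- products, converge almost everywhere.
  obtain ⟨m, hm, hFm⟩ := (tendstoInMeasure_of_tendsto_Lp hF1).exists_seq_tendsto_ae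
  obtain ⟨l, hl, hGl⟩ := (tendstoInMeasure_of_tendsto_Lp
    (hG1.comp hm.tendsto_atTop)).exists_seq_tendsto_ae
  have hk : Tendsto (fun n => m (l n)) atTop atTop := hm.tendsto_atTop.comp hl.tendsto_atTop
  refine exists_scal_of_tendsto_ae (P := fun n => P (m (l n))) ?_ (fun n => hPB _)
    (Tendsto.comp (g := fun n => √(2 / L * ‖F n‖ ^ 2 + 2 * L * ‖weakDeriv L 0 (F n)‖ ^ 2)
      * ‖weakDeriv L 1 (G n)‖) ?_ hk)
  · filter_upwards [hFm, hGl, ae_all_iff.2 hP] with x h1 h2 h3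
    simp_rw [h3]
    exact (h1.comp hl.tendsto_atTop).mul h2
  · exact (Real.continuous_sqrt.tendsto _ |>.comp (((hF1.norm.pow 2).const_mul _).add
      (((hF2 0).norm.pow 2).const_mul _))).mul (hG2 1).norm

/-! ### The space `V₀` -/

lemma mem_V0 {L : ℝ} {u : Vec L} (hu : u ∈ V0 L) : (∀ i, u i ∈ sobolev1 L) ∧
    ∃ U : ℕ → Vec L, (∀ n, U n ∈ testVec L) ∧ (∀ i, Tendsto (fun n => U n i) atTop (𝓝 (u i))) ∧
      ∀ i j, Tendsto (fun n => weakDeriv L j (U n i)) atTop (𝓝 (weakDeriv L j (u i))) := by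
  refine ⟨hu.1, ?_⟩
  obtain ⟨x, hx, hlim⟩ := mem_closure_iff_seq_limit.1 hu.2
  choose U hU hUx using hx
  obtain rfl : (fun n => jetVec L (U n)) = x := funext hUx
  rw [Prod.tendsto_iff] at hlim
  refine ⟨U, hU, fun i => ?_, fun i => tendsto_pi_nhds.1 (tendsto_pi_nhds.1 hlim.2 i)⟩
  exact ((PiLp.continuous_apply 2 _ i).tendsto u).comp hlim.1

/-- Lets the scalar product estimate be applied to velocity components. -/
lemma coord_mem_V1_of_mem_V0 {L : ℝ} {u : Vec L} (hu : u ∈ V0 L) (i : Fin 2) : u i ∈ V1 L := by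
  obtain ⟨h, U, hU, h1, h2⟩ := mem_V0 hu
  refine mem_V1_iff.2 ⟨h i, fun n => U n i, fun n => ?_, h1 i, h2 i⟩
  obtain ⟨φ, hφ, _, hUφ⟩ := hU n
  exact ⟨φ i, hφ i, hUφ i⟩

/-! ### The operators `A₁` and `B₁` -/

lemma H1_eq_top {L : ℝ} (hL : 0 < L) : H1 L = ⊤ := by
  rw [H1, Submodule.topologicalClosure_eq_top_iff, Submodule.eq_bot_iff]
  intro g hg
  refine scal_eq_zero_of_forall_test hL fun φ hφ => ?_
  have h := ofContinuous_ae L φ hφ.contDiff.continuous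
  rw [← inner_scal_congr (EventuallyEq.refl _ _) h]
  exact Submodule.inner_left_of_mem_orthogonal (Submodule.subset_span (show _ ∈ testScal L from ⟨φ, hφ, h⟩)) hg

lemma inner_A1 {L : ℝ} (hL : 0 < L) {θ φ : Scal L} (hθ : θ ∈ domA1 L) (hφ : φ ∈ V1 L) :
    inner ℝ (A1 L θ) φ = form1 L θ φ := by
  have h : ∃ f ∈ H1 L, ∀ φ ∈ V1 L, inner ℝ f φ = form1 L θ φ := by
    -- The witness is `-Δθ`. It represents the form on test functions by the definition of weak
    -- derivatives, and on `V₁` by density.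
    refine ⟨-∑ j, weakDeriv L j (weakDeriv L j θ), by rw [H1_eq_top hL]; trivial, fun φ hφ => ?_⟩
    obtain ⟨_, F, hF, hF1, hF2⟩ := mem_V1_iff.1 hφ
    have l1 : Tendsto (fun n => inner ℝ (-∑ j, weakDeriv L j (weakDeriv L j θ)) (F n)) atTop
        (𝓝 (inner ℝ (-∑ j, weakDeriv L j (weakDeriv L j θ)) φ)) := tendsto_const_nhds.inner hF1
    have l2 : Tendsto (fun n => form1 L θ (F n)) atTop (𝓝 (form1 L θ φ)) :=
      tendsto_finsetSum _ fun j _ => tendsto_const_nhds.inner (hF2 j)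
    refine tendsto_nhds_unique l1 (l2.congr fun n => ?_)
    obtain ⟨ψ, hψ, hFψ⟩ := hF n
    rw [form1, inner_neg_left, sum_inner, ← Finset.sum_neg_distrib]
    refine Finset.sum_congr rfl fun j _ => ?_
    rw [inner_scal_congr (EventuallyEq.refl _ _) hFψ, inner_scal_congr (EventuallyEq.refl _ _)
      ((hψ.isChannelField hL).weakDeriv_ae hL hFψ j)]
    exact hasWeakDeriv_weakDeriv (hθ.2.2 j) j ψ hψ
  rw [A1, dif_pos h]
  exact h.choose_spec.2 φ hφ

/-- Grouping `uⱼ φ` together, an `L²` function, turns the trilinear integral into `L²` inner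
products, from which linearity and continuity in `θ` follow. -/
lemma B1_eq_sum_inner {L : ℝ} {u : Vec L} {φ : Scal L} {P : Fin 2 → Scal L}
    (hP : ∀ j, P j =ᵐ[cell L] fun x => u j x * φ x) (θ : Scal L) :
    B1 L u θ φ = ∑ j, inner ℝ (weakDeriv L j θ) (P j) := by
  simp_rw [inner_scal]
  rw [← integral_finsetSum _ fun j _ => integrable_scal_mul _ _]
  refine integral_congr_ae ?_
  filter_upwards [ae_all_iff.2 hP] with x hx
  rw [Finset.sum_mul]
  exact Finset.sum_congr rfl fun j _ => by rw [hx]; ring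

lemma B1_sub {L : ℝ} (hL : 0 < L) {u : Vec L} (hu : u ∈ V0 L) {θ₁ θ₂ φ : Scal L}
    (hθ₁ : θ₁ ∈ V1 L) (hθ₂ : θ₂ ∈ V1 L) (hφ : φ ∈ V1 L) :
    B1 L u (θ₁ - θ₂) φ = B1 L u θ₁ φ - B1 L u θ₂ φ := by
  choose P hP _ using fun j => exists_mul_of_mem_V1 hL (coord_mem_V1_of_mem_V0 hu j) hφ
  simp_rw [B1_eq_sum_inner hP, weakDeriv_sub hL hθ₁.1 hθ₂.1, inner_sub_left,
    Finset.sum_sub_distrib]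

lemma form1_sub {L : ℝ} (hL : 0 < L) {θ₁ θ₂ φ : Scal L}
    (hθ₁ : θ₁ ∈ V1 L) (hθ₂ : θ₂ ∈ V1 L) :
    form1 L (θ₁ - θ₂) φ = form1 L θ₁ φ - form1 L θ₂ φ := by
  simp_rw [form1, weakDeriv_sub hL hθ₁.1 hθ₂.1, inner_sub_left, Finset.sum_sub_distrib]

/-- For fixed smooth `f`, the expression is `L²`-continuous in the velocity, so approximating `u` by
divergence-free test fields reduces it to the classical identity. -/
lemma B1_self_of_mem_testScal {L : ℝ} (hL : 0 < L) {u : Vec L} (hu : u ∈ V0 L) {f : Scal L}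
    (hf : f ∈ testScal L) : B1 L u f f = 0 := by
  obtain ⟨φ, hφ, hfφ⟩ := hf
  have hc := hφ.isChannelField hL
  have c1 := hc.contDiff.continuous
  have c2 := continuous_pderiv hc.contDiff
  have c3 : ∀ j, Continuous fun x => φ x * pderiv j φ x := fun j => c1.mul (c2 j)
  have e : ∀ v : Vec L, (∀ j, v j ∈ V1 L) →
      B1 L v f f = ∑ j, inner ℝ (v j) (ofContinuous L _ (c3 j)) := by
    intro v hv
    simp_rw [fun j => inner_scal_congr (EventuallyEq.refl _ (v j)) (ofContinuous_ae L _ (c3 j))]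
    rw [← integral_finsetSum _ fun j _ => integrable_scal_mul_continuous _ (c3 j)]
    refine integral_congr_ae ?_
    filter_upwards [hfφ, ae_all_iff.2 fun j => hc.weakDeriv_ae hL hfφ j] with x h1 h2
    rw [Finset.sum_mul]
    exact Finset.sum_congr rfl fun j _ => by rw [h1, h2]; ring
  rw [e u (coord_mem_V1_of_mem_V0 hu)]
  obtain ⟨_, U, hU, hU1, _⟩ := mem_V0 hu
  refine tendsto_nhds_unique (tendsto_finsetSum _ fun j _ => (hU1 j).inner tendsto_const_nhds)
    (tendsto_const_nhds.congr fun n => ?_)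
  obtain ⟨w, hw, hdiv, hUw⟩ := hU n
  simp_rw [fun j => inner_scal_congr (hUw j) (ofContinuous_ae L _ (c3 j))]
  exact (IsChannelField.integral_transport hL (fun j => (hw j).isChannelField hL) hdiv hc).symm

/-- Transport by a divergence-free field is skew-symmetric: `⟨B₁(u, f), f⟩ = 0`. -/
lemma B1_self {L : ℝ} (hL : 0 < L) {u : Vec L} (hu : u ∈ V0 L) {f : Scal L}
    (hf : f ∈ V1 L) : B1 L u f f = 0 := by
  have hu1 := coord_mem_V1_of_mem_V0 hu
  obtain ⟨_, F, hF, hF1, hF2⟩ := mem_V1_iff.1 hf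
  have hFV := fun n => testScal_subset_V1 hL (hF n)
  choose P hP _ using fun j => exists_mul_of_mem_V1 hL (hu1 j) hf
  choose Q hQ hQB using fun n j => exists_mul_of_mem_V1 hL (hu1 j) (V1_sub hL (hFV n) hf)
  have hPQ : ∀ n j, (P j + Q n j : Scal L) =ᵐ[cell L] fun x => u j x * F n x := fun n j => by
    filter_upwards [Lp.coeFn_add (P j) (Q n j), hP j, hQ n j, Lp.coeFn_sub (F n) f]
      with x h1 h2 h3 h4
    rw [h1, Pi.add_apply, h2, h3, h4, Pi.sub_apply]
    ring
  -- `Q n j` is `uⱼ (F n - f)`, controlled by the `H¹` convergence of `F n`; hence `uⱼ F n` tends to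
  -- `uⱼ f` in `L²`.
  have hQ0 : ∀ j, Tendsto (fun n => Q n j) atTop (𝓝 0) := by
    intro j
    refine squeeze_zero_norm (fun n => hQB n j) ?_
    have h : Tendsto (fun n => weakDeriv L 1 (F n - f)) atTop (𝓝 0) := by
      simp_rw [fun n => weakDeriv_sub hL (hFV n).1 hf.1]
      simpa using (hF2 1).sub_const (weakDeriv L 1 f)
    simpa using h.norm.const_mul _
  rw [B1_eq_sum_inner hP]
  refine tendsto_nhds_unique (f := fun n => ∑ j, inner ℝ (weakDeriv L j (F n)) (P j + Q n j))
    (l := atTop) (tendsto_finsetSum _ fun j _ => ?_) (tendsto_const_nhds.congr fun n => ?_)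
  · simpa using (hF2 j).inner (tendsto_const_nhds.add (hQ0 j))
  · rw [← B1_eq_sum_inner (hPQ n), B1_self_of_mem_testScal hL hu (hF n)]

/-! ### The energy identity -/

lemma absolutelyContinuousOnInterval_of_dist_le {f g : ℝ → ℝ} {a b C : ℝ}
    (hg : AbsolutelyContinuousOnInterval g a b)
    (h : ∀ x ∈ uIcc a b, ∀ y ∈ uIcc a b, dist (f x) (f y) ≤ C * dist (g x) (g y)) :
    AbsolutelyContinuousOnInterval f a b := by
  unfold AbsolutelyContinuousOnInterval at hg ⊢
  have h0 := hg.const_mul C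
  rw [mul_zero] at h0
  refine squeeze_zero' (Eventually.of_forall fun E => Finset.sum_nonneg fun _ _ => dist_nonneg)
    ?_ h0
  filter_upwards [mem_inf_of_right (mem_principal_self _)] with E hE
  rw [Finset.mul_sum]
  exact Finset.sum_le_sum fun i hi => h _ (hE.1 i hi).1 _
    (hE.1 i hi).2

/-- The energy identity for a primitive of an integrable function in a Hilbert space. -/
lemma norm_sq_sub_norm_sq_eq_integral {E : Type*} [NormedAddCommGroup E] [InnerProductSpace ℝ E]
    [CompleteSpace E] {a b : ℝ} (hab : a ≤ b) {v v' : ℝ → E}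
    (hv' : IntervalIntegrable v' volume a b)
    (hv : ∀ t ∈ Icc a b, v t = v a + ∫ s in a..t, v' s) :
    ‖v b‖ ^ 2 - ‖v a‖ ^ 2 = ∫ t in a..b, 2 * inner ℝ (v' t) (v t) := by
  set w : ℝ → E := fun t => v a + ∫ s in a..t, v' s with hw
  have hii : ∀ x ∈ Icc a b, ∀ y ∈ Icc a b, IntervalIntegrable v' volume x y := by
    intro x hx y hy
    refine hv'.mono_set ?_
    rw [uIcc_of_le hab]
    exact uIcc_subset_Icc hx hy
  have hdiff : ∀ x ∈ Icc a b, ∀ y ∈ Icc a b, ‖w x - w y‖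
      ≤ dist (∫ s in a..x, ‖v' s‖) (∫ s in a..y, ‖v' s‖) := by
    intro x hx y hy
    have ha := left_mem_Icc.2 hab
    rw [hw, Real.dist_eq, intervalIntegral.integral_interval_sub_left (hii a ha x hx).norm
      (hii a ha y hy).norm]
    simp only [add_sub_add_left_eq_sub]
    rw [intervalIntegral.integral_interval_sub_left (hii a ha x hx) (hii a ha y hy)]
    exact intervalIntegral.norm_integral_le_abs_integral_norm
  have hac := hv'.norm.absolutelyContinuousOnInterval_intervalIntegral (c := a) left_mem_uIcc
  obtain ⟨M, hM⟩ : ∃ M, ∀ x ∈ Icc a b, ‖w x‖ ≤ M := by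
    obtain ⟨C, hC⟩ := hac.exists_bound
    refine ⟨‖v a‖ + C, fun x hx => ?_⟩
    rw [uIcc_of_le hab] at hC
    have h1 := hdiff x hx a (left_mem_Icc.2 hab)
    have h2 := hC x hx
    have h3 : w a = v a := by simp [hw]
    rw [h3, intervalIntegral.integral_same, dist_zero_right] at h1
    have := norm_le_norm_add_norm_sub' (w x) (v a)
    linarith
  -- The increments of `‖w‖²` are at most `2 M` times those of `∫ ‖v'‖`. Absolute continuity then
  -- permits integrating the almost everywhere derivative.
  have hF : AbsolutelyContinuousOnInterval (fun t => ‖w t‖ ^ 2) a b := by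
    refine absolutelyContinuousOnInterval_of_dist_le (C := 2 * M) hac fun x hx y hy => ?_
    rw [uIcc_of_le hab] at hx hy
    have hM0 : 0 ≤ M := (norm_nonneg _).trans (hM x hx)
    rw [Real.dist_eq, sq_sub_sq, abs_mul, abs_of_nonneg (by positivity)]
    have h1 := hM x hx
    have h2 := hM y hy
    exact mul_le_mul (by linarith) ((abs_norm_sub_norm_le _ _).trans (hdiff x hx y hy))
      (abs_nonneg _) (by linarith)
  have key := hF.integral_deriv_eq_sub
  rw [hv b (right_mem_Icc.2 hab)]
  change ‖w b‖ ^ 2 - _ = _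
  rw [show v a = w a by simp [hw], ← key]
  refine intervalIntegral.integral_congr_ae ?_
  filter_upwards [hv'.ae_hasDerivAt_integral] with t ht hmem
  have hmem' := uIoc_subset_uIcc hmem
  have h1 : HasDerivAt w (v' t) t := (ht hmem' a left_mem_uIcc).const_add _
  rw [h1.norm_sq.deriv, real_inner_comm, hv t (by rwa [uIcc_of_le hab] at hmem')]

/-! ### Decay of the difference of two temperatures -/

/-- Test both equations with `θ₁ - θ₂` and subtract: the sources cancel, the transport term is zero
by `B1_self`, and Poincaré's inequality bounds the Dirichlet form below. -/
lemma inner_temperature_sub_le {κ L : ℝ} (hκ : 0 < κ) (hL : 0 < L)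
    {u : Vec L} (hu : u ∈ V0 L) {θ₁ θ₂ θ₁' θ₂' : Scal L} (h₁ : θ₁ ∈ domA1 L) (h₂ : θ₂ ∈ domA1 L)
    (e₁ : ∀ φ ∈ V1 L, inner ℝ θ₁' φ + κ * inner ℝ (A1 L θ₁) φ + B1 L u θ₁ φ - inner ℝ (u 1) φ = 0)
    (e₂ : ∀ φ ∈ V1 L, inner ℝ θ₂' φ + κ * inner ℝ (A1 L θ₂) φ + B1 L u θ₂ φ - inner ℝ (u 1) φ = 0) :
    inner ℝ (θ₁' - θ₂') (θ₁ - θ₂) ≤ -κ * ‖θ₁ - θ₂‖ ^ 2 := by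
  have hη := V1_sub hL h₁.1 h₂.1
  have e₁ := e₁ _ hη
  have e₂ := e₂ _ hη
  have hB := B1_sub hL hu h₁.1 h₂.1 hη
  rw [B1_self hL hu hη] at hB
  have hA := form1_sub hL h₁.1 h₂.1 (φ := θ₁ - θ₂)
  rw [inner_A1 hL h₁ hη] at e₁
  rw [inner_A1 hL h₂ hη] at e₂
  have hP : ‖θ₁ - θ₂‖ ^ 2 ≤ form1 L (θ₁ - θ₂) (θ₁ - θ₂) := by
    refine (norm_sq_le_of_mem_V1 hL hη).trans ?_
    rw [form1, Fin.sum_univ_two, real_inner_self_eq_norm_sq, real_inner_self_eq_norm_sq]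
    linarith [sq_nonneg ‖weakDeriv L 0 (θ₁ - θ₂)‖]
  rw [inner_sub_left]
  nlinarith [mul_le_mul_of_nonneg_left hP hκ.le]

/-- Two temperatures driven by the same velocity approach each other. -/
lemma IsStrongSolution.norm_sq_temperature_sub_le {ν κ L a b : ℝ} (hκ : 0 < κ) (hL : 0 < L)
    (hab : a ≤ b) {u : ℝ → Vec L} {θ₁ θ₂ : ℝ → Scal L} (h₁ : IsStrongSolution ν κ L a b u θ₁)
    (h₂ : IsStrongSolution ν κ L a b u θ₂) :
    ‖θ₁ b - θ₂ b‖ ^ 2 ≤ ‖θ₁ a - θ₂ a‖ ^ 2 - 2 * κ * ∫ t in a..b, ‖θ₁ t - θ₂ t‖ ^ 2 := by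
  obtain ⟨θ₁', m₁, i₁, e₁⟩ := h₁.temperature
  obtain ⟨θ₂', m₂, i₂, e₂⟩ := h₂.temperature
  have hint : ∀ {f : ℝ → Scal L}, MemLp f 2 (volume.restrict (Icc a b)) →
      IntervalIntegrable f volume a b := fun hf => by
    rw [intervalIntegrable_iff_integrableOn_Icc_of_le hab]
    exact hf.integrable (by norm_num)
  have hi := (hint m₁).sub (hint m₂)
  have hη : ∀ t ∈ Icc a b, (θ₁ - θ₂) t = (θ₁ - θ₂) a + ∫ s in a..t, (θ₁' - θ₂') s := by
    intro t ht
    have hsub : uIcc a t ⊆ uIcc a b := by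
      rw [uIcc_of_le hab, uIcc_of_le ht.1]; exact Icc_subset_Icc_right ht.2
    simp only [Pi.sub_apply]
    rw [intervalIntegral.integral_sub ((hint m₁).mono_set hsub) ((hint m₂).mono_set hsub), i₁ t ht,
      i₂ t ht]
    abel
  have hcont : ContinuousOn (fun t => θ₁ t - θ₂ t) (Icc a b) :=
    (continuous_fst.comp_continuousOn h₁.cont_θ).sub (continuous_fst.comp_continuousOn h₂.cont_θ)
  have key := norm_sq_sub_norm_sq_eq_integral (v' := θ₁' - θ₂') hab hi hη
  have hI₁ : IntervalIntegrable (fun t => 2 * inner ℝ ((θ₁' - θ₂') t) ((θ₁ - θ₂) t)) volume a b := by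
    refine IntervalIntegrable.const_mul ?_ 2
    obtain ⟨C, hC⟩ := isCompact_Icc.exists_bound_of_continuousOn hcont
    rw [intervalIntegrable_iff_integrableOn_Icc_of_le hab] at hi ⊢
    have hm := hcont.aestronglyMeasurable measurableSet_Icc (μ := volume)
    refine Integrable.mono' (hi.norm.mul_const C) (hi.aestronglyMeasurable.inner hm) ?_
    filter_upwards [ae_restrict_mem measurableSet_Icc] with t ht
    exact (norm_inner_le_norm _ _).trans (mul_le_mul_of_nonneg_left (hC t ht) (norm_nonneg _))
  have hI₂ : IntervalIntegrable (fun t => -(2 * κ) * ‖θ₁ t - θ₂ t‖ ^ 2) volume a b := by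
    refine ContinuousOn.intervalIntegrable ?_
    rw [uIcc_of_le hab]
    exact (hcont.norm.pow 2).const_mul _
  have hle := intervalIntegral.integral_mono_ae_restrict hab hI₁ hI₂ <| by
    filter_upwards [e₁, e₂, h₁.mem_dom_θ, h₂.mem_dom_θ, ae_restrict_mem measurableSet_Icc]
      with t e₁ e₂ d₁ d₂ ht
    have := inner_temperature_sub_le hκ hL (h₁.memV0 t ht) d₁ d₂ e₁.2 e₂.2
    simp only [Pi.sub_apply]
    linarith
  rw [← key, intervalIntegral.integral_const_mul] at hle
  simp only [Pi.sub_apply] at hle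
  linarith

end Benard

theorem proposition3p1 (ν κ L : ℝ) (hν : 0 < ν) (hκ : 0 < κ) (hL : 0 < L)
    (𝒜 : Set (Benard.Vec L × Benard.Scal L)) (h𝒜 : Benard.IsGlobalAttractor ν κ L 𝒜)
    (u₁ u₂ : ℝ → Benard.Vec L) (θ₁ θ₂ : ℝ → Benard.Scal L)
    (h₁ : Benard.IsCompleteTrajectoryIn ν κ L 𝒜 u₁ θ₁)
    (h₂ : Benard.IsCompleteTrajectoryIn ν κ L 𝒜 u₂ θ₂)
    (hu : ∀ t : ℝ, u₁ t = u₂ t) :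
    ∀ t : ℝ, θ₁ t = θ₂ t := by
  obtain rfl : u₁ = u₂ := funext hu
  obtain ⟨C, hC⟩ := h𝒜.compact.isBounded.exists_norm_le
  have hbound : ∀ t, ‖θ₁ t - θ₂ t‖ ^ 2 ≤ (2 * C) ^ 2 := fun t => by
    have e₁ := (norm_snd_le _).trans (hC _ (h₁.mem t))
    have e₂ := (norm_snd_le _).trans (hC _ (h₂.mem t))
    have := norm_sub_le (θ₁ t) (θ₂ t)
    exact pow_le_pow_left₀ (norm_nonneg _) (by simp only at e₁ e₂; linarith) 2
  have hdecay : ∀ a b, a ≤ b → ‖θ₁ b - θ₂ b‖ ^ 2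
      ≤ ‖θ₁ a - θ₂ a‖ ^ 2 - 2 * κ * ∫ t in a..b, ‖θ₁ t - θ₂ t‖ ^ 2 := fun a b hab =>
    Benard.IsStrongSolution.norm_sq_temperature_sub_le hκ hL hab (h₁.solution a b hab)
      (h₂.solution a b hab)
  have hmono : ∀ a b, a ≤ b → ‖θ₁ b - θ₂ b‖ ^ 2 ≤ ‖θ₁ a - θ₂ a‖ ^ 2 := fun a b hab => by
    have h0 : 0 ≤ ∫ t in a..b, ‖θ₁ t - θ₂ t‖ ^ 2 :=
      intervalIntegral.integral_nonneg hab fun _ _ => sq_nonneg _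
    nlinarith [hdecay a b hab]
  intro t
  by_contra hne
  have hpos : 0 < ‖θ₁ t - θ₂ t‖ ^ 2 := by
    have := norm_pos_iff.2 (sub_ne_zero.2 hne)
    positivity
  set d := ‖θ₁ t - θ₂ t‖ ^ 2
  -- By monotonicity the squared distance is at least `d` throughout `[t - T, t]`, so the dissipated
  -- amount is at least `2 κ T d`, while the value at `t - T` is at most `(2 C)²`. This replaces
  -- Gronwall's lemma.
  have hT : ∀ T : ℝ, 0 ≤ T → 2 * κ * (T * d) ≤ (2 * C) ^ 2 := by
    intro T hT
    have hab : t - T ≤ t := by linarith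
    have hcont : ContinuousOn (fun s => ‖θ₁ s - θ₂ s‖ ^ 2) (uIcc (t - T) t) := by
      rw [uIcc_of_le hab]
      exact ((continuous_fst.comp_continuousOn (h₁.solution _ _ hab).cont_θ).sub
        (continuous_fst.comp_continuousOn (h₂.solution _ _ hab).cont_θ)).norm.pow 2
    have hle : ∫ _ in (t - T)..t, d ≤ ∫ s in (t - T)..t, ‖θ₁ s - θ₂ s‖ ^ 2 :=
      intervalIntegral.integral_mono_on hab (by simp) hcont.intervalIntegrable
        fun s hs => hmono s t hs.2
    rw [intervalIntegral.integral_const, smul_eq_mul, sub_sub_cancel] at hle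
    have h1 := mul_le_mul_of_nonneg_left hle (by positivity : 0 ≤ 2 * κ)
    linarith [hdecay _ _ hab, hbound (t - T)]
  -- This `T` makes the left side exactly `(2 C)² + 1`.
  have h := hT (((2 * C) ^ 2 + 1) / (2 * κ * d)) (by positivity)
  rw [show 2 * κ * (((2 * C) ^ 2 + 1) / (2 * κ * d) * d) = (2 * C) ^ 2 + 1 by field_simp] at h
  linarith
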